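/- Let $T>0$, $\mathbb T^3=\mathbb R^3/\mathbb Z^3$, $\theta\in(0,1/3)$ and $r\in\left(\frac{3}{2+3\theta},\infty\right]$, with $\frac{r-1}{r}=\frac{r}{r-1}=1$ if $r=\infty$. For $p\in[1,\infty]$ let $B^\theta_{p,\infty}(\mathbb T^3)$ be the space of $f\in L^p(\mathbb T^3;\mathbb R^3)$ with $[f]_{B^\theta_{p,\infty}}:=\sup_{h\neq0}|h|^{-\theta}\|f(h+\cdot)-f\|_{L^p}<\infty$, with norm $\|f\|_{B^\theta_{p,\infty}}=\|f\|_{L^p}+[f]_{B^\theta_{p,\infty}}$. Let $v\in L^3((0,T);B^\theta_{3r,\infty}(\mathbb T^3))\cap C^0([0,T];L^2(\mathbb T^3;\mathbb R^3))$, where the first membership means that $v(t)\in B^\theta_{3r,\infty}(\mathbb T^3)$ for a.e. $t$ and $\int_0^T\|v(t)\|_{B^\theta_{3r,\infty}}^3\,dt<\infty$. Suppose that $v$ is a weak solution of the incompressible Euler equations $\partial_t v+\operatorname{div}(v\otimes v)+\nabla p=0$, $\operatorname{div}v=0$ on $\mathbb T^3\times[0,T]$, that is, $v\in L^2(\mathbb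 T^3\times[0,T];\mathbb R^3)$, $$\int_0^T\!\!\int_{\mathbb T^3}\big(v\cdot\partial_t\varphi+v\otimes v:\nabla\varphi\big)\,dx\,dt=0\quad\text{for all }\varphi\in C_c^\infty(\mathbb T^3\times(0,T);\mathbb R^3)\text{ with }\operatorname{div}\varphi=0,$$ and $\int_0^T\int_{\mathbb T^3}v\cdot\nabla\psi\,dx\,dt=0$ for all $\psi\in C_c^\infty(\mathbb T^3\times(0,T))$. Suppose that for a.e. $t\in[0,T]$ there is a closed set $S_t\subseteq\mathbb T^3$ such that the following hold. (i) The uniform-in-time upper Minkowski dimension $$\gamma:=\inf\Big\{s\ge0:\ \limsup_{\varepsilon\downarrow0}\ \operatorname*{ess\,sup}_{t\in[0,T]}\,(2\varepsilon)^{s-3}\,\mathcal H^3\big((S_t)_\varepsilon\big)=0\Big\}$$ satisfies $\gamma<3$, where $(S_t)_\varepsilon$ is the set of points of $\mathbb T^3$ at distance at most $\varepsilon$ from $S_t$ (empty if $S_t=\emptyset$). (ii) There are $\kappa$ with $0\le\kappa<\frac{r-1}{r}\cdot\frac{3(1-\theta)}{1-3\theta}$ and $C\in L^3((0,T))$ such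 that, for a.e. $t\in[0,T]$, $v(t)\in C^1(\mathbb T^3\setminus S_t)$ (after modification on a null set) and $$|\nabla v(x,t)|\le C(t)\,\operatorname{dist}(x,S_t)^{-\kappa}\qquad\text{for all }x\in\mathbb T^3\setminus S_t,$$ with the convention $\operatorname{dist}(x,\emptyset)=1$. If $$\gamma<\begin{cases}3-\frac{r}{r-1}(1-3\theta)&\text{if }\kappa\le1-\theta,\\[2pt] 3-\frac{\kappa}{1-\theta}\cdot\frac{r}{r-1}(1-3\theta)&\text{if }\kappa>1-\theta,\end{cases}$$ then $v$ conserves the kinetic energy $e_v(t):=\frac12\int_{\mathbb T^3}|v(x,t)|^2\,dx$, that is, $e_v(t)=e_v(0)$ for every $t\in[0,T]$. -/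

import Mathlib

open MeasureTheory Set Filter Topology
open scoped ENNReal ContDiff

namespace EulerTorus

/-- Three-dimensional Euclidean space. Functions on the torus `𝕋³ = ℝ³ / ℤ³` are represented by their
`ℤ³`-periodic extensions to `ℝ³`, and subsets of the torus by `ℤ³`-periodic subsets of `ℝ³`. -/
abbrev E3 : Type := EuclideanSpace ℝ (Fin 3)

/-- `f` is `ℤ³`-periodic. For a set `S`, `IsPeriodic (fun x => x ∈ S)` says that `S` is invariant
under integer translations. -/
def IsPeriodic {α : Type*} (f : E3 → α) : Prop :=
  ∀ (i : Fin 3) (x : E3), f (x + EuclideanSpace.single i (1 : ℝ)) = f x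

/-- The unit cube, a fundamental domain of the torus. -/
def cube : Set E3 := {x | ∀ i, x i ∈ Ico (0 : ℝ) 1}

/-- Lebesgue measure on the torus, as Lebesgue measure on the unit cube. -/
noncomputable def torusMeasure : Measure E3 := volume.restrict cube

/-! ### Besov spaces -/

/-- The seminorm `[f]_{B^θ_{p,∞}} = sup_{h ≠ 0} ‖f(h + ·) - f‖_{L^p} / |h|^θ`. -/
noncomputable def besovSeminorm (θ : ℝ) (p : ℝ≥0∞) (f : E3 → E3) : ℝ≥0∞ :=
  ⨆ (h : E3) (_ : h ≠ 0),
    eLpNorm (fun x => f (h + x) - f x) p torusMeasure / ENNReal.ofReal (‖h‖ ^ θ)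

/-- The norm `‖f‖_{L^p} + [f]_{B^θ_{p,∞}}`. -/
noncomputable def besovNorm (θ : ℝ) (p : ℝ≥0∞) (f : E3 → E3) : ℝ≥0∞ :=
  eLpNorm f p torusMeasure + besovSeminorm θ p f

/-- Membership in `B^θ_{p,∞}(𝕋³)`. -/
def MemBesov (θ : ℝ) (p : ℝ≥0∞) (f : E3 → E3) : Prop :=
  MemLp f p torusMeasure ∧ besovSeminorm θ p f < ⊤

/-- `v ∈ L³((0,T); B^θ_{p,∞}(𝕋³))`: almost every time slice is in the Besov space, and the cube of
its Besov norm is integrable in time. -/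
def MemL3Besov (T θ : ℝ) (p : ℝ≥0∞) (v : ℝ → E3 → E3) : Prop :=
  (∀ᵐ t ∂(volume.restrict (Ioo 0 T)), MemBesov θ p (v t)) ∧
    ∫⁻ t in Ioo 0 T, besovNorm θ p (v t) ^ 3 < ⊤

/-- `v ∈ C⁰([0,T]; L²(𝕋³))`. -/
def ContinuousInL2 (T : ℝ) (v : ℝ → E3 → E3) : Prop :=
  (∀ t ∈ Icc 0 T, MemLp (v t) 2 torusMeasure) ∧
    ∀ t₀ ∈ Icc 0 T, Tendsto (fun t => eLpNorm (fun x => v t x - v t₀ x) 2 torusMeasure)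
      (𝓝[Icc 0 T] t₀) (𝓝 0)

/-! ### Weak solutions of the Euler equations -/

/-- Test functions in `C_c^∞(𝕋³ × (0,T); F)`. As the torus is compact, compact support means that
`φ` vanishes for times outside a compact subinterval of `(0,T)`; `φ` is extended by zero to all
times. -/
structure IsTestFunction {F : Type*} [NormedAddCommGroup F] [NormedSpace ℝ F]
    (T : ℝ) (φ : ℝ → E3 → F) : Prop where
  smooth : ContDiff ℝ ∞ (fun z : ℝ × E3 => φ z.1 z.2)
  periodic : ∀ t, IsPeriodic (φ t)
  support : ∃ a b : ℝ, 0 < a ∧ b < T ∧ ∀ t, t ∉ Icc a b → ∀ x, φ t x = 0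

/-- The divergence `∑ᵢ ∂ᵢ fᵢ` of a differentiable vector field. -/
noncomputable def divergence (f : E3 → E3) (x : E3) : ℝ :=
  ∑ i : Fin 3, fderiv ℝ f x (EuclideanSpace.single i 1) i

/-- `v` is a weak solution on `𝕋³ × [0,T]` of the incompressible Euler equations
`∂ₜ v + div (v ⊗ v) + ∇ p = 0`, `div v = 0`. Here `v ⊗ v : ∇ φ = ∑ᵢⱼ vᵢ vⱼ ∂ⱼ φᵢ` is written as the
inner product of `v` with the derivative of `φ` in direction `v`. -/
structure IsWeakEulerSolution (T : ℝ) (v : ℝ → E3 → E3) : Prop where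
  periodic : ∀ t ∈ Icc 0 T, IsPeriodic (v t)
  memL2 : MemLp (fun z : ℝ × E3 => v z.1 z.2) 2 ((volume.restrict (Icc 0 T)).prod torusMeasure)
  momentum : ∀ φ : ℝ → E3 → E3, IsTestFunction T φ → (∀ t x, divergence (φ t) x = 0) →
    ∫ t in Ioo 0 T, ∫ x, (inner ℝ (v t x) (deriv (fun s => φ s x) t)
      + inner ℝ (v t x) (fderiv ℝ (φ t) x (v t x))) ∂torusMeasure = 0
  divergenceFree : ∀ ψ : ℝ → E3 → ℝ, IsTestFunction T ψ →
    ∫ t in Ioo 0 T, ∫ x, fderiv ℝ (ψ t) x (v t x) ∂torusMeasure = 0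

/-- The kinetic energy `e_v(t) = ½ ∫ |v(x,t)|² dx`. -/
noncomputable def kineticEnergy (v : ℝ → E3 → E3) (t : ℝ) : ℝ :=
  (1 / 2) * ∫ x, ‖v t x‖ ^ 2 ∂torusMeasure

/-! ### Singular sets -/

/-- The uniform-in-time upper Minkowski content
`limsup_{ε ↓ 0} esssup_{t ∈ [0,T]} (2ε)^{s-3} |(S_t)_ε|`, where `(S_t)_ε` is the closed
`ε`-neighbourhood in the torus. For a periodic set the Euclidean distance to it is the torus
distance. -/
noncomputable def minkowskiContent (T : ℝ) (S : ℝ → Set E3) (s : ℝ) : ℝ≥0∞ :=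
  limsup (fun ε : ℝ => essSup
    (fun t => ENNReal.ofReal ((2 * ε) ^ (s - 3)) * torusMeasure (Metric.cthickening ε (S t)))
    (volume.restrict (Icc 0 T))) (𝓝[>] 0)

/-- The uniform-in-time upper Minkowski dimension of the family `S`. -/
noncomputable def minkowskiDim (T : ℝ) (S : ℝ → Set E3) : ℝ :=
  sInf {s : ℝ | 0 ≤ s ∧ minkowskiContent T S s = 0}

open Classical in
/-- The distance to a set, with the convention that the distance to the empty set is `1`. -/
noncomputable def distTo (S : Set E3) (x : E3) : ℝ :=
  if S = ∅ then 1 else Metric.infDist x S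

/-- `f` is of class `C¹` off the closed set `S` (after modification on a null set), with
`|∇ f (x)| ≤ c dist(x, S)^{-κ}` for all `x ∉ S`. -/
def IsC1OffWithBlowup (f : E3 → E3) (S : Set E3) (c κ : ℝ) : Prop :=
  ∃ u : E3 → E3, u =ᵐ[volume.restrict Sᶜ] f ∧ ContDiffOn ℝ 1 u Sᶜ ∧
    ∀ x ∉ S, ‖fderiv ℝ u x‖ ≤ c * distTo S x ^ (-κ)

/-- `(r - 1) / r = 1 - 1 / r` as a real number, equal to `1` for `r = ∞`. Its inverse is
`r / (r - 1)`. -/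
noncomputable def conjRatio (r : ℝ≥0∞) : ℝ := 1 - (r⁻¹).toReal

end EulerTorus

/-! Pair `v` with its spatial mollification `v_ε`, for an even kernel of radius `ε`, and follow
`E_ε(t) = ∫ v · v_ε dx`. The field `v_ε` frozen at one time is a divergence-free test field, so the
pressure drops out. Evenness of the kernel cancels the cross terms, and uniform continuity of `v` in
`L²` lets the frozen field move again. The outcome is `|E_ε(t) - E_ε(0)| ≤ 2 ∫ |∫ v ⊗ v : ∇v_ε dx|
dt` (`IsMollifier.enorm_energy_sub_le`). The Duchon–Robert identity (`IsMollifier.flux_mollify_eq`)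
rewrites the flux through increments, hence bounds it by a multiple of `ε⁻¹ sup_{|y| ≤ ε} ‖v(· - y)
- v‖³` in `L³`.

Cut the torus at distance `ε^α` from `S_t`, and let `c = 1 - 1/r`. For some `s` below the bound
imposed on the dimension, the near part has measure `O(ε^{α(3-s)})`, so Hölder and Besov regularity
give `ε^{3θ + α(3-s)c}`. On the far part the mean value inequality gives `ε³ dist^{-3κ}`. A factor
`dist^{-q}` with `q < 3 - s` is integrable by a dyadic decomposition (`lintegral_distTo_rpow_le`),
and the remaining factor costs `ε^{-α(3κ-q)}`.

After division by `ε` two exponents must be positive: `3θ - 1 + α(3-s)c` and `2 - α(3κ-q)`. The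
first asks for `α > β`, where `β = (1-3θ)/((3-s)c)`. The dimension bound, in both of its cases,
yields `β < 1` and `κβ < 1-θ`. As `c ≤ 1`, also `β(3-s) ≥ 1-3θ`, whence `β(3κ-(3-s)) < 3(1-θ) -
(1-3θ) = 2`. So `α` slightly above `β` and a suitable `q` meet both conditions (`exists_exponents`).

Thus the time-integrated flux vanishes as `ε → 0`. At almost every time `v(t)` is a Besov field and
`E_ε(t)` tends to `‖v(t)‖²`, so the energies at almost all times agree; continuity in `L²` gives the
remaining times. -/

namespace EulerTorus

open scoped Pointwise

/-! ### Integration of periodic functions -/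

/-- The standard basis of `ℝ³`, whose integral span is the lattice `ℤ³`. -/
noncomputable abbrev latticeBasis : Module.Basis (Fin 3) ℝ E3 :=
  (EuclideanSpace.basisFun (Fin 3) ℝ).toBasis

/-- The lattice `ℤ³`. -/
noncomputable abbrev lattice : AddSubgroup E3 :=
  (Submodule.span ℤ (Set.range latticeBasis)).toAddSubgroup

lemma cube_eq_fundamentalDomain : cube = ZSpan.fundamentalDomain latticeBasis := by
  ext x
  simp [cube, ZSpan.fundamentalDomain, latticeBasis]

lemma volume_cube : volume cube = 1 := by
  rw [cube_eq_fundamentalDomain]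
  have h := (EuclideanSpace.basisFun (Fin 3) ℝ).volume_parallelepiped
  rw [← h]
  exact measure_congr (ZSpan.fundamentalDomain_ae_parallelepiped latticeBasis volume)

instance : IsProbabilityMeasure torusMeasure :=
  ⟨by simp [torusMeasure, volume_cube]⟩

lemma torusMeasure_le_volume : torusMeasure ≤ volume := Measure.restrict_le_self

/-- Invariance under the three generators propagates to their integral span. This is the form that
the theory of fundamental domains requires. -/
lemma IsPeriodic.vadd {α : Type*} {f : E3 → α} (hf : IsPeriodic f)
    (g : lattice) (x : E3) : f (g +ᵥ x) = f x := by
  obtain ⟨g, hg⟩ := g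
  change f (g + x) = f x
  change g ∈ Submodule.span ℤ (Set.range latticeBasis) at hg
  induction hg using Submodule.span_induction generalizing x with
  | mem y hy =>
    obtain ⟨i, rfl⟩ := hy
    rw [add_comm]
    simpa [latticeBasis] using hf i x
  | zero => simp
  | add y z _ _ hy hz => rw [add_assoc, hy, hz]
  | smul a y _ hy =>
    have hn : ∀ (n : ℕ) x, f (n • y + x) = f x := by
      intro n
      induction n with
      | zero => simp
      | succ n ih => intro x; rw [succ_nsmul, add_assoc, ih, hy]
    obtain ⟨n, rfl | rfl⟩ := a.eq_nat_or_neg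
    · simpa using hn n x
    · have := hn n (-(n • y) + x)
      rw [add_neg_cancel_left] at this
      simpa using this.symm

lemma IsPeriodic.comp_add_right {α : Type*} {f : E3 → α} (hf : IsPeriodic f) (y : E3) :
    IsPeriodic (fun x => f (x + y)) := by
  intro i x
  simpa only [add_right_comm] using hf i (x + y)

lemma IsPeriodic.comp_sub_right {α : Type*} {f : E3 → α} (hf : IsPeriodic f) (y : E3) :
    IsPeriodic (fun x => f (x - y)) := by
  simpa only [sub_eq_add_neg] using hf.comp_add_right (-y)

lemma IsPeriodic.comp {α β : Type*} {f : E3 → α} (hf : IsPeriodic f) (g : α → β) :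
    IsPeriodic (fun x => g (f x)) := fun i x => congrArg g (hf i x)

lemma IsPeriodic.comp₂ {α β γ : Type*} {f : E3 → α} {f' : E3 → β} (hf : IsPeriodic f)
    (hf' : IsPeriodic f') (g : α → β → γ) : IsPeriodic (fun x => g (f x) (f' x)) := by
  intro i x
  simp only [hf i x, hf' i x]

/-- Translations commute with the lattice action. Translation invariance of torus integrals follows,
since shifting the integrand amounts to shifting the cube. -/
lemma isAddFundamentalDomain_vadd_cube (y : E3) :
    IsAddFundamentalDomain lattice (y +ᵥ cube)
      (volume : Measure E3) := by
  rw [cube_eq_fundamentalDomain]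
  exact (ZSpan.isAddFundamentalDomain' latticeBasis volume).vadd_of_comm y

lemma isAddFundamentalDomain_cube :
    IsAddFundamentalDomain lattice cube
      (volume : Measure E3) := by
  simpa using isAddFundamentalDomain_vadd_cube 0

instance : Countable lattice :=
  inferInstanceAs (Countable (Submodule.span ℤ (Set.range latticeBasis)))

lemma preimage_add_vadd_cube (y : E3) : (fun x => x + y) ⁻¹' (y +ᵥ cube) = cube := by
  ext x
  simp [Set.mem_vadd_set_iff_neg_vadd_mem, add_comm x]

lemma setLIntegral_vadd_cube {f : E3 → ℝ≥0∞} (hf : IsPeriodic f) (y : E3) :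
    ∫⁻ x in y +ᵥ cube, f x = ∫⁻ x, f x ∂torusMeasure :=
  (isAddFundamentalDomain_vadd_cube y).setLIntegral_eq isAddFundamentalDomain_cube f
    fun g x => hf.vadd g x

lemma lintegral_torus_comp_add {f : E3 → ℝ≥0∞} (hf : IsPeriodic f) (y : E3) :
    ∫⁻ x, f (x + y) ∂torusMeasure = ∫⁻ x, f x ∂torusMeasure := by
  rw [← setLIntegral_vadd_cube hf y, torusMeasure]
  have := (measurePreserving_add_right (volume : Measure E3) y).setLIntegral_comp_preimage_emb
    (MeasurableEquiv.addRight y).measurableEmbedding f (y +ᵥ cube)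
  rwa [preimage_add_vadd_cube] at this

lemma integral_torus_comp_add {F : Type*} [NormedAddCommGroup F] [NormedSpace ℝ F] {f : E3 → F}
    (hf : IsPeriodic f) (y : E3) :
    ∫ x, f (x + y) ∂torusMeasure = ∫ x, f x ∂torusMeasure := by
  have h1 : ∫ x in y +ᵥ cube, f x = ∫ x, f x ∂torusMeasure :=
    (isAddFundamentalDomain_vadd_cube y).setIntegral_eq isAddFundamentalDomain_cube
      fun g x => hf.vadd g x
  rw [← h1, torusMeasure]
  have := (measurePreserving_add_right (volume : Measure E3) y).setIntegral_preimage_emb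
    (MeasurableEquiv.addRight y).measurableEmbedding f (y +ᵥ cube)
  rwa [preimage_add_vadd_cube] at this

lemma integral_torus_comp_sub {F : Type*} [NormedAddCommGroup F] [NormedSpace ℝ F] {f : E3 → F}
    (hf : IsPeriodic f) (y : E3) :
    ∫ x, f (x - y) ∂torusMeasure = ∫ x, f x ∂torusMeasure := by
  simpa only [sub_eq_add_neg] using integral_torus_comp_add hf (-y)

/-- Every point has a translate of the unit cube as a neighbourhood. -/
lemma closedBall_subset_vadd_cube (x : E3) {ρ : ℝ} (hρ : ρ < 1 / 2) :
    Metric.closedBall x ρ ⊆ (x - WithLp.toLp 2 (fun _ => (1 / 2 : ℝ))) +ᵥ cube := by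
  intro y hy
  rw [Set.mem_vadd_set_iff_neg_vadd_mem]
  intro i
  have h1 : |y i - x i| ≤ ρ := by
    have := PiLp.norm_apply_le (y - x) i
    rw [← dist_eq_norm] at this
    exact (le_trans (by simpa using this) (Metric.mem_closedBall.1 hy))
  rw [abs_le] at h1
  simp only [vadd_eq_add, PiLp.add_apply, PiLp.neg_apply, PiLp.sub_apply]
  constructor <;> linarith

lemma IsPeriodic.aestronglyMeasurable_vadd_cube {F : Type*} [NormedAddCommGroup F] {f : E3 → F}
    (hf : IsPeriodic f) (h : AEStronglyMeasurable f torusMeasure) (y : E3) :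
    AEStronglyMeasurable f (volume.restrict (y +ᵥ cube)) :=
  ((isAddFundamentalDomain_vadd_cube y).aestronglyMeasurable_on_iff isAddFundamentalDomain_cube
    fun g x => hf.vadd g x).2 h

lemma IsPeriodic.integrableOn_vadd_cube {F : Type*} [NormedAddCommGroup F] {f : E3 → F}
    (hf : IsPeriodic f) (h : Integrable f torusMeasure) (y : E3) :
    IntegrableOn f (y +ᵥ cube) :=
  ((isAddFundamentalDomain_vadd_cube y).integrableOn_iff isAddFundamentalDomain_cube
    fun g x => hf.vadd g x).2 h

lemma IsPeriodic.locallyIntegrable {F : Type*} [NormedAddCommGroup F] {f : E3 → F}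
    (hf : IsPeriodic f) (h : Integrable f torusMeasure) : LocallyIntegrable f := fun x =>
  ⟨Metric.closedBall x (1 / 4), Metric.closedBall_mem_nhds x (by norm_num),
    (hf.integrableOn_vadd_cube h _).mono_set (closedBall_subset_vadd_cube x (by norm_num))⟩

lemma IsPeriodic.aestronglyMeasurable {F : Type*} [NormedAddCommGroup F] {f : E3 → F}
    (hf : IsPeriodic f) (h : AEStronglyMeasurable f torusMeasure) :
    AEStronglyMeasurable f volume := by
  obtain ⟨s, hs, hU⟩ := TopologicalSpace.countable_cover_nhds
    (f := fun x : E3 => Metric.closedBall x (1 / 4))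
    fun x => Metric.closedBall_mem_nhds x (by norm_num)
  have : Countable s := hs.to_subtype
  rw [← Measure.restrict_univ (μ := (volume : Measure E3)), ← hU, biUnion_eq_iUnion,
    aestronglyMeasurable_iUnion_iff]
  intro x
  exact (hf.aestronglyMeasurable_vadd_cube h _).mono_set
    (closedBall_subset_vadd_cube (x : E3) (by norm_num))

lemma IsPeriodic.aestronglyMeasurable_comp_sub {F : Type*} [NormedAddCommGroup F] {f : E3 → F}
    (hf : IsPeriodic f) (h : AEStronglyMeasurable f torusMeasure) (y : E3) :
    AEStronglyMeasurable (fun x => f (x - y)) torusMeasure :=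
  ((hf.aestronglyMeasurable h).comp_quasiMeasurePreserving
    (measurePreserving_sub_right volume y).quasiMeasurePreserving).restrict

/-- Translates of a periodic `Lᵖ` function are in `Lᵖ`, for finite `p`. -/
lemma IsPeriodic.memLp_comp_sub {F : Type*} [NormedAddCommGroup F] {f : E3 → F} {p : ℝ≥0∞}
    (hp0 : p ≠ 0) (hp : p ≠ ⊤) (hf : IsPeriodic f) (h : MemLp f p torusMeasure) (y : E3) :
    MemLp (fun x => f (x - y)) p torusMeasure := by
  refine ⟨hf.aestronglyMeasurable_comp_sub h.1 y, ?_⟩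
  have h2 := h.2
  rw [eLpNorm_lt_top_iff_lintegral_rpow_enorm_lt_top hp0 hp] at h2 ⊢
  have := lintegral_torus_comp_add (hf.comp (fun z => ‖z‖ₑ ^ p.toReal)) (-y)
  simp only [← sub_eq_add_neg] at this
  rwa [this]

lemma IsPeriodic.norm_integrableOn {F : Type*} [NormedAddCommGroup F] {f : E3 → F}
    (hf : IsPeriodic f) (h : Integrable f torusMeasure) (x : E3) {ρ : ℝ} (hρ : ρ < 1 / 2) :
    IntegrableOn (fun z => ‖f z‖) (Metric.closedBall x ρ) :=
  ((hf.integrableOn_vadd_cube h _).mono_set (closedBall_subset_vadd_cube x hρ)).norm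

lemma IsPeriodic.setIntegral_norm_closedBall_le {F : Type*} [NormedAddCommGroup F] {f : E3 → F}
    (hf : IsPeriodic f) (h : Integrable f torusMeasure) (x : E3) {ρ : ℝ} (hρ : ρ < 1 / 2) :
    ∫ z in Metric.closedBall x ρ, ‖f z‖ ≤ ∫ z, ‖f z‖ ∂torusMeasure := by
  have h1 := (isAddFundamentalDomain_vadd_cube
    (x - WithLp.toLp 2 (fun _ => (1 / 2 : ℝ)))).setIntegral_eq isAddFundamentalDomain_cube
      (f := fun z => ‖f z‖) fun g x => (hf.comp norm).vadd g x
  rw [torusMeasure, ← h1]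
  exact setIntegral_mono_set (hf.integrableOn_vadd_cube h _).norm
    (Eventually.of_forall fun _ => norm_nonneg _) (closedBall_subset_vadd_cube x hρ).eventuallyLE

/-- A continuous periodic function is bounded. -/
lemma IsPeriodic.exists_bound {F : Type*} [NormedAddCommGroup F] {f : E3 → F}
    (hf : IsPeriodic f) (h : Continuous f) : ∃ M, 0 ≤ M ∧ ∀ x, ‖f x‖ ≤ M := by
  obtain ⟨M, hM⟩ := (ZSpan.fundamentalDomain_isBounded latticeBasis).isCompact_closure
    |>.exists_bound_of_continuousOn h.continuousOn
  have key : ∀ x, ‖f x‖ ≤ M := by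
    intro x
    have h1 := hf.vadd (-⟨ZSpan.floor latticeBasis x, (ZSpan.floor latticeBasis x).2⟩) x
    rw [← h1]
    refine hM _ (subset_closure ?_)
    have := ZSpan.fract_mem_fundamentalDomain latticeBasis x
    rw [ZSpan.fract_apply] at this
    rwa [sub_eq_neg_add] at this
  exact ⟨M, (norm_nonneg _).trans (key 0), key⟩

/-! ### Mollification -/

/-- A nonnegative even smooth function of integral one supported in the ball of radius `ε`. -/
structure IsMollifier (η : E3 → ℝ) (ε : ℝ) : Prop where
  smooth : ContDiff ℝ ∞ η
  even : ∀ y, η (-y) = η y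
  nonneg : ∀ y, 0 ≤ η y
  integral_eq_one : ∫ y, η y = 1
  support : ∀ y, ε < ‖y‖ → η y = 0

/-- The convolution of a kernel `η` with `f`. -/
noncomputable def mollify (η : E3 → ℝ) (f : E3 → E3) : E3 → E3 :=
  convolution η f (ContinuousLinearMap.lsmul ℝ ℝ) volume

lemma mollify_apply (η : E3 → ℝ) (f : E3 → E3) (x : E3) :
    mollify η f x = ∫ y, η y • f (x - y) := rfl

lemma IsPeriodic.mollify {η : E3 → ℝ} {f : E3 → E3} (hf : IsPeriodic f) :
    IsPeriodic (mollify η f) := by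
  intro i x
  simp only [mollify_apply, add_sub_right_comm, hf i _]

namespace IsMollifier

variable {η : E3 → ℝ} {ε : ℝ} (hη : IsMollifier η ε)
include hη

lemma hasCompactSupport : HasCompactSupport η :=
  HasCompactSupport.intro (isCompact_closedBall (0 : E3) ε) fun x hx =>
    hη.support x (by simpa using hx)

lemma fderiv_eq_zero {y : E3} (hy : ε < ‖y‖) : fderiv ℝ η y = 0 := by
  have : η =ᶠ[𝓝 y] fun _ => 0 := by
    filter_upwards [(isOpen_lt continuous_const continuous_norm).mem_nhds hy] with z hz
      using hη.support z hz
  rw [this.fderiv_eq]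
  simp

lemma continuous_fderiv : Continuous (fderiv ℝ η) :=
  hη.smooth.continuous_fderiv (by simp)

lemma exists_fderiv_bound : ∃ K, 0 ≤ K ∧ ∀ y, ‖fderiv ℝ η y‖ ≤ K := by
  obtain ⟨K, hK⟩ := (hη.hasCompactSupport.fderiv (𝕜 := ℝ)).exists_bound_of_continuous
    hη.continuous_fderiv
  exact ⟨K, (norm_nonneg _).trans (hK 0), hK⟩

lemma integrable_fderiv : Integrable (fderiv ℝ η) :=
  hη.continuous_fderiv.integrable_of_hasCompactSupport (hη.hasCompactSupport.fderiv (𝕜 := ℝ))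

lemma integrable : Integrable η :=
  hη.smooth.continuous.integrable_of_hasCompactSupport hη.hasCompactSupport

lemma fderiv_neg (y : E3) : fderiv ℝ η (-y) = -fderiv ℝ η y := by
  have hd : HasFDerivAt η (fderiv ℝ η (-y)) (-y) :=
    (hη.smooth.differentiable (by simp) _).hasFDerivAt
  have h := hd.comp y (hasFDerivAt_id y).neg
  rw [show (η ∘ Neg.neg) = η from funext hη.even] at h
  rw [h.fderiv]
  ext u
  simp

variable {f : E3 → E3} (hf : IsPeriodic f) (hint : Integrable f torusMeasure)
include hf hint

lemma contDiff_mollify : ContDiff ℝ ∞ (mollify η f) :=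
  hη.hasCompactSupport.contDiff_convolution_left _ hη.smooth (hf.locallyIntegrable hint)

lemma integrable_fderiv_smul (x u : E3) :
    Integrable (fun y => (fderiv ℝ η y u) • f (x - y)) := by
  have hc : HasCompactSupport (fun y => fderiv ℝ η y u) :=
    (hη.hasCompactSupport.fderiv (𝕜 := ℝ)).comp_left (g := fun L : E3 →L[ℝ] ℝ => L u) (by simp)
  exact (hc.convolutionExists_left (ContinuousLinearMap.lsmul ℝ ℝ)
    (hη.continuous_fderiv.clm_apply continuous_const) (hf.locallyIntegrable hint) x)

lemma fderiv_mollify_apply (x u : E3) :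
    fderiv ℝ (mollify η f) x u = ∫ y, (fderiv ℝ η y u) • f (x - y) := by
  have hloc := hf.locallyIntegrable hint
  have h := hη.hasCompactSupport.hasFDerivAt_convolution_left (ContinuousLinearMap.lsmul ℝ ℝ)
    (hη.smooth.of_le (by simp)) hloc x
  have hex := (hη.hasCompactSupport.fderiv (𝕜 := ℝ)).convolutionExists_left
    (ContinuousLinearMap.precompL E3 (ContinuousLinearMap.lsmul ℝ ℝ : ℝ →L[ℝ] E3 →L[ℝ] E3))
    hη.continuous_fderiv hloc x
  rw [mollify, h.fderiv, convolution, ContinuousLinearMap.integral_apply hex]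
  rfl

lemma divergence_mollify (x : E3) :
    divergence (mollify η f) x = ∫ y, fderiv ℝ η y (f (x - y)) := by
  have hi : ∀ i : Fin 3, Integrable
      (fun y => (fderiv ℝ η y (EuclideanSpace.single i 1) • f (x - y)) i) := fun i =>
    (EuclideanSpace.proj (𝕜 := ℝ) i).integrable_comp
      (hη.integrable_fderiv_smul hf hint x (EuclideanSpace.single i 1))
  simp only [divergence, hη.fderiv_mollify_apply hf hint]
  have h1 : ∀ i : Fin 3, (∫ y, fderiv ℝ η y (EuclideanSpace.single i 1) • f (x - y)) i
      = ∫ y, (fderiv ℝ η y (EuclideanSpace.single i 1) • f (x - y)) i := fun i =>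
    ((EuclideanSpace.proj (𝕜 := ℝ) i).integral_comp_comm
      (hη.integrable_fderiv_smul hf hint x (EuclideanSpace.single i 1))).symm
  simp only [h1]
  rw [← integral_finsetSum _ fun i _ => hi i]
  congr 1 with y
  conv_rhs => rw [← (EuclideanSpace.basisFun (Fin 3) ℝ).sum_repr (f (x - y))]
  simp [mul_comm]

/-- The derivative falls on the kernel. For `ε < 1/2` the supporting ball fits into one translated
cube, so the periodic field is counted at most once. -/
lemma norm_fderiv_mollify_le (hε : ε < 1 / 2) {K : ℝ} (hK : ∀ y, ‖fderiv ℝ η y‖ ≤ K) (x : E3) :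
    ‖fderiv ℝ (mollify η f) x‖ ≤ K * ∫ z, ‖f z‖ ∂torusMeasure := by
  have hK0 : 0 ≤ K := (norm_nonneg _).trans (hK 0)
  refine ContinuousLinearMap.opNorm_le_bound _ (by positivity) fun u => ?_
  rw [hη.fderiv_mollify_apply hf hint]
  have hon := hf.norm_integrableOn hint x hε
  calc ‖∫ y, (fderiv ℝ η y u) • f (x - y)‖
      ≤ ∫ y, ‖(fderiv ℝ η y u) • f (x - y)‖ := norm_integral_le_integral_norm _
    _ = ∫ z, ‖(fderiv ℝ η (x - z) u) • f z‖ := by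
        rw [← integral_sub_left_eq_self _ _ x]; simp
    _ ≤ ∫ z, (Metric.closedBall x ε).indicator (fun z => K * ‖u‖ * ‖f z‖) z := by
        refine integral_mono_of_nonneg (Eventually.of_forall fun _ => norm_nonneg _) ?_
          (Eventually.of_forall fun z => ?_)
        · exact (integrable_indicator_iff Metric.isClosed_closedBall.measurableSet).2
            (hon.const_mul _)
        · by_cases hz : z ∈ Metric.closedBall x ε
          · rw [indicator_of_mem hz]
            simp only [norm_smul]
            gcongr
            exact (ContinuousLinearMap.le_opNorm _ _).trans (by gcongr; exact hK _)
          · rw [indicator_of_notMem hz]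
            dsimp only
            rw [hη.fderiv_eq_zero (y := x - z)]
            · simp
            · rw [Metric.mem_closedBall, not_le, dist_comm, dist_eq_norm] at hz
              exact hz
    _ = K * ‖u‖ * ∫ z in Metric.closedBall x ε, ‖f z‖ := by
        rw [integral_indicator Metric.isClosed_closedBall.measurableSet, integral_const_mul]
    _ ≤ K * ‖u‖ * ∫ z, ‖f z‖ ∂torusMeasure := by
        exact mul_le_mul_of_nonneg_left (hf.setIntegral_norm_closedBall_le hint x hε)
          (by positivity)
    _ = _ := by ring

end IsMollifier

/-! ### Fubini on the torus times the space of increments -/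

lemma IsPeriodic.aestronglyMeasurable_sub_prod {F : Type*} [NormedAddCommGroup F] {f : E3 → F}
    (hf : IsPeriodic f) (h : AEStronglyMeasurable f torusMeasure) :
    AEStronglyMeasurable (fun z : E3 × E3 => f (z.1 - z.2)) (torusMeasure.prod volume) := by
  have h1 := (hf.aestronglyMeasurable h).comp_quasiMeasurePreserving
    (quasiMeasurePreserving_sub (μ := (volume : Measure E3)) (ν := (volume : Measure E3)))
  refine h1.mono_measure ?_
  exact Measure.prod_mono Measure.restrict_le_self le_rfl

/-- Supplies the Fubini hypothesis below: slices in `x` are bounded uniformly in the shift `y` by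
translation invariance, and the kernel provides integrability in `y`. -/
lemma integrable_prod_of_slice_le {F : Type*} [NormedAddCommGroup F] {H : E3 × E3 → F}
    (hH : AEStronglyMeasurable H (torusMeasure.prod volume)) {k : E3 → ℝ} (hk : Integrable k)
    {M : ℝ≥0∞} (hM : M ≠ ⊤) (h : ∀ y, ∫⁻ x, ‖H (x, y)‖ₑ ∂torusMeasure ≤ ‖k y‖ₑ * M) :
    Integrable H (torusMeasure.prod volume) := by
  refine ⟨hH, ?_⟩
  rw [HasFiniteIntegral, lintegral_prod_symm _ hH.enorm]
  calc ∫⁻ y, ∫⁻ x, ‖H (x, y)‖ₑ ∂torusMeasure ≤ ∫⁻ y, ‖k y‖ₑ * M := lintegral_mono h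
    _ = (∫⁻ y, ‖k y‖ₑ) * M := lintegral_mul_const' _ _ hM
    _ < ⊤ := ENNReal.mul_lt_top hk.2 hM.lt_top

/-! ### Integration by parts -/

lemma fderiv_comp_add (h : E3 → ℝ) (y x : E3) :
    fderiv ℝ (fun z => h (z + y)) x = fderiv ℝ h (x + y) := by
  simpa using fderiv_comp_add_right (𝕜 := ℝ) (f := h) (x := x) y

lemma IsPeriodic.fderiv {F : Type*} [NormedAddCommGroup F] [NormedSpace ℝ F] {h : E3 → F}
    (hp : IsPeriodic h) : IsPeriodic (fderiv ℝ h) := by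
  intro i x
  rw [← fderiv_comp_add_right, show (fun z => h (z + EuclideanSpace.single i 1)) = h from
    funext (hp i)]

/-- Continuous functions on the torus are integrable. -/
lemma IsPeriodic.integrable_of_continuous {F : Type*} [NormedAddCommGroup F]
    {f : E3 → F} (hf : IsPeriodic f) (h : Continuous f) : Integrable f torusMeasure := by
  obtain ⟨M, _, hM⟩ := hf.exists_bound h
  exact Integrable.of_bound h.aestronglyMeasurable M (Eventually.of_forall hM)

/-- The function `s ↦ ∫ h(x + s u) dx` is constant by translation invariance; differentiate it under
the integral at `s = 0`. -/
lemma integral_fderiv_eq_zero {h : E3 → ℝ} (hd : ContDiff ℝ 1 h) (hp : IsPeriodic h) (u : E3) :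
    ∫ x, fderiv ℝ h x u ∂torusMeasure = 0 := by
  have hc : Continuous (fderiv ℝ h) := hd.continuous_fderiv (by simp)
  obtain ⟨M, hM0, hM⟩ := hp.fderiv.exists_bound hc
  have key := hasDerivAt_integral_of_dominated_loc_of_deriv_le (μ := torusMeasure)
    (F := fun (s : ℝ) (x : E3) => h (x + s • u)) (x₀ := 0) (s := univ)
    (F' := fun s x => fderiv ℝ h (x + s • u) u) (bound := fun _ => M * ‖u‖) univ_mem
    (Eventually.of_forall fun s => by
      have := hd.continuous
      exact (by fun_prop : Continuous fun x => h (x + s • u)).aestronglyMeasurable)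
    (by simpa using hp.integrable_of_continuous hd.continuous)
    (by
      have : Continuous fun x => fderiv ℝ h (x + (0 : ℝ) • u) u := by fun_prop
      exact this.aestronglyMeasurable)
    (Eventually.of_forall fun x s _ => (ContinuousLinearMap.le_opNorm _ _).trans
      (by gcongr; exact hM _))
    (integrable_const _)
    (Eventually.of_forall fun x s _ => by
      have h1 : HasFDerivAt h (fderiv ℝ h (x + s • u)) (x + s • u) :=
        (hd.differentiable (by simp) _).hasFDerivAt
      have h2 : HasDerivAt (fun s : ℝ => x + s • u) u s := by
        simpa using ((hasDerivAt_id s).smul_const u).const_add x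
      exact h1.comp_hasDerivAt s h2)
  have h3 : (fun s : ℝ => ∫ x, h (x + s • u) ∂torusMeasure) =
      fun _ => ∫ x, h x ∂torusMeasure := funext fun s => integral_torus_comp_add hp (s • u)
  have h4 := key.2
  rw [h3] at h4
  simpa using h4.unique (hasDerivAt_const _ _)

lemma continuous_divergence {g : E3 → E3} (hg : ContDiff ℝ ∞ g) :
    ContDiff ℝ ∞ (divergence g) := by
  have : ContDiff ℝ ∞ (fderiv ℝ g) := hg.fderiv_right (by simp)
  refine ContDiff.sum fun i _ => ?_
  exact (EuclideanSpace.proj (𝕜 := ℝ) i).contDiff.comp (this.clm_apply contDiff_const)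

lemma IsPeriodic.divergence {g : E3 → E3} (hp : IsPeriodic g) : IsPeriodic (divergence g) := by
  intro i x
  simp only [EulerTorus.divergence, hp.fderiv i x]

lemma fderiv_eq_sum (ψ : E3 → ℝ) (x w : E3) :
    fderiv ℝ ψ x w = ∑ i, fderiv ℝ ψ x (EuclideanSpace.single i 1) * w i := by
  conv_lhs => rw [← (EuclideanSpace.basisFun (Fin 3) ℝ).sum_repr w]
  simp [mul_comm]

/-- The integrand is `div (ψ g)`, a sum of partial derivatives of periodic functions. -/
lemma integral_fderiv_add_divergence {ψ : E3 → ℝ} (hψ : ContDiff ℝ 1 ψ) (hψp : IsPeriodic ψ)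
    {g : E3 → E3} (hg : ContDiff ℝ 1 g) (hgp : IsPeriodic g) :
    ∫ x, fderiv ℝ ψ x (g x) + ψ x * divergence g x ∂torusMeasure = 0 := by
  have hgi : ∀ i : Fin 3, ContDiff ℝ 1 (fun x => g x i) := fun i =>
    (EuclideanSpace.proj (𝕜 := ℝ) i).contDiff.comp hg
  have hgfd : ∀ (i : Fin 3) x u, fderiv ℝ (fun x => g x i) x u = fderiv ℝ g x u i := by
    intro i x u
    have := ((EuclideanSpace.proj (𝕜 := ℝ) i).hasFDerivAt.comp x
      (hg.differentiable (by simp) x).hasFDerivAt).fderiv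
    exact congrArg (fun L => L u) this
  have h1 : ∀ x, fderiv ℝ ψ x (g x) + ψ x * divergence g x =
      ∑ i, fderiv ℝ (fun x => ψ x * g x i) x (EuclideanSpace.single i 1) := by
    intro x
    have h2 : ∀ i : Fin 3, fderiv ℝ (fun x => ψ x * g x i) x (EuclideanSpace.single i 1) =
        ψ x * fderiv ℝ g x (EuclideanSpace.single i 1) i +
        g x i * fderiv ℝ ψ x (EuclideanSpace.single i 1) := by
      intro i
      rw [fderiv_fun_mul (hψ.differentiable (by simp) x) ((hgi i).differentiable (by simp) x)]
      simp [hgfd]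
    simp only [h2, Finset.sum_add_distrib, divergence, Finset.mul_sum]
    rw [fderiv_eq_sum ψ x (g x), add_comm]
    simp only [mul_comm]
  simp only [h1]
  rw [integral_finsetSum]
  · refine Finset.sum_eq_zero fun i _ => integral_fderiv_eq_zero (hψ.mul (hgi i))
      (hψp.comp₂ (hgp.comp fun z => z i) _) _
  · intro i _
    have hmul : ContDiff ℝ 1 (fun x => ψ x * g x i) := hψ.mul (hgi i)
    have hper : IsPeriodic (fun x => ψ x * g x i) := hψp.comp₂ (hgp.comp fun z => z i) _
    exact (hper.fderiv.comp fun L => L (EuclideanSpace.single i 1)).integrable_of_continuous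
      ((hmul.continuous_fderiv (by simp)).clm_apply continuous_const)

lemma eq_zero_of_integral_sq_eq_zero {q : E3 → ℝ} (hq : Continuous q) (hp : IsPeriodic q)
    (h : ∫ x, q x * q x ∂torusMeasure = 0) (x₀ : E3) : q x₀ = 0 := by
  set c : E3 := WithLp.toLp 2 (fun _ => (1 / 2 : ℝ)) with hc
  have hper : IsPeriodic (fun x => q x * q x) := hp.comp₂ hp _
  -- Shifting `x₀` to the centre of the cube leaves room for a ball around it, wherever `x₀` lies.
  rw [← integral_torus_comp_add hper (x₀ - c)] at h
  rw [integral_eq_zero_iff_of_nonneg (fun x => mul_self_nonneg _)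
    ((hper.comp_add_right _).integrable_of_continuous (by fun_prop))] at h
  have hsub : Metric.ball c (1 / 4) ⊆ cube := by
    refine Metric.ball_subset_closedBall.trans ?_
    have := closedBall_subset_vadd_cube c (ρ := 1 / 4) (by norm_num)
    rwa [← hc, sub_self, zero_vadd] at this
  have h2 : (fun x => q (x + (x₀ - c)) * q (x + (x₀ - c))) =ᵐ[volume.restrict (Metric.ball c (1 / 4))]
      fun _ => 0 := ae_restrict_of_ae_restrict_of_subset hsub h
  have h3 := Measure.eqOn_open_of_ae_eq h2 Metric.isOpen_ball (by fun_prop) (by fun_prop)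
    (Metric.mem_ball_self (by norm_num) : c ∈ Metric.ball c (1 / 4))
  simpa using h3

/-- Periodic vector fields that are divergence free in the sense of distributions. -/
def IsWeaklyDivFree (f : E3 → E3) : Prop :=
  ∀ ψ : E3 → ℝ, ContDiff ℝ ∞ ψ → IsPeriodic ψ → ∫ x, fderiv ℝ ψ x (f x) ∂torusMeasure = 0

/-! ### Mollification preserves the divergence constraint. -/

namespace IsMollifier

variable {η : E3 → ℝ} {ε : ℝ} (hη : IsMollifier η ε)
include hη

lemma integrable_smul {f : E3 → E3} (hf : IsPeriodic f) (hint : Integrable f torusMeasure) (x : E3) :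
    Integrable (fun y => η y • f (x - y)) :=
  hη.hasCompactSupport.convolutionExists_left (ContinuousLinearMap.lsmul ℝ ℝ)
    hη.smooth.continuous (hf.locallyIntegrable hint) x

/-- By Fubini and translation invariance the shift by `y` moves onto the test function, which
remains an admissible test function. -/
lemma isWeaklyDivFree_mollify {f : E3 → E3} (hf : IsPeriodic f)
    (hint : Integrable f torusMeasure) (hdiv : IsWeaklyDivFree f) :
    IsWeaklyDivFree (mollify η f) := by
  intro ψ hψ hψp
  have hc : Continuous (fderiv ℝ ψ) := hψ.continuous_fderiv (by simp)
  obtain ⟨M, hM0, hM⟩ := hψp.fderiv.exists_bound hc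
  have h1 : ∀ x, fderiv ℝ ψ x (mollify η f x) = ∫ y, η y * fderiv ℝ ψ x (f (x - y)) := by
    intro x
    rw [mollify_apply, ← ContinuousLinearMap.integral_comp_comm _ (hη.integrable_smul hf hint x)]
    simp
  simp only [h1]
  rw [integral_integral_swap]
  · refine integral_eq_zero_of_ae (Eventually.of_forall fun y => ?_)
    simp only [Pi.zero_apply]
    rw [integral_const_mul]
    have h2 := hdiv (fun z => ψ (z + y)) (hψ.comp (contDiff_id.add contDiff_const))
      (hψp.comp_add_right y)
    have h3 := integral_torus_comp_sub
      ((hψp.fderiv.comp_add_right y).comp₂ hf fun (L : E3 →L[ℝ] ℝ) w => L w) y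
    simp only [sub_add_cancel] at h3
    simp only [fderiv_comp_add] at h2
    rw [h3, h2, mul_zero]
  · refine integrable_prod_of_slice_le (k := η) (M := ENNReal.ofReal M * ∫⁻ x, ‖f x‖ₑ ∂torusMeasure)
      ?_ hη.integrable (ENNReal.mul_ne_top (by simp) hint.2.ne) fun y => ?_
    · have hm := hf.aestronglyMeasurable_sub_prod hint.1
      refine (hη.smooth.continuous.comp continuous_snd).aestronglyMeasurable.mul ?_
      exact isBoundedBilinearMap_apply.continuous.comp_aestronglyMeasurable
        ((hc.comp continuous_fst).aestronglyMeasurable.prodMk hm)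
    · have h4 := lintegral_torus_comp_add (hf.comp (fun z => ‖z‖ₑ)) (-y)
      simp only [← sub_eq_add_neg] at h4
      rw [← h4, ← lintegral_const_mul' _ _ (by simp), ← lintegral_const_mul' _ _ (by simp)]
      refine lintegral_mono fun x => ?_
      simp only [Function.uncurry_apply_pair, enorm_mul]
      gcongr
      refine (ContinuousLinearMap.le_opENorm _ _).trans ?_
      gcongr
      rw [← ofReal_norm]
      exact ENNReal.ofReal_le_ofReal (hM x)

/-- Test the weak constraint for the mollified field with its own divergence: the integral of its
square vanishes. -/
lemma divergence_mollify_eq_zero {f : E3 → E3} (hf : IsPeriodic f)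
    (hint : Integrable f torusMeasure) (hdiv : IsWeaklyDivFree f) (x : E3) :
    divergence (mollify η f) x = 0 := by
  have hs := hη.contDiff_mollify hf hint
  have hd := continuous_divergence hs
  have hdp : IsPeriodic (divergence (mollify η f)) := hf.mollify.divergence
  refine eq_zero_of_integral_sq_eq_zero hd.continuous hdp ?_ x
  have h1 := integral_fderiv_add_divergence (hd.of_le (by simp)) hdp (hs.of_le (by simp)) hf.mollify
  rw [integral_add, hη.isWeaklyDivFree_mollify hf hint hdiv _ hd hdp, zero_add] at h1
  · exact h1
  · refine (hdp.fderiv.comp₂ hf.mollify fun (L : E3 →L[ℝ] ℝ) w => L w).integrable_of_continuous ?_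
    exact (hd.continuous_fderiv (by simp)).clm_apply hs.continuous
  · exact (hdp.comp₂ hdp _).integrable_of_continuous (hd.continuous.mul hd.continuous)

end IsMollifier

lemma IsPeriodic.lintegral_comp_sub {f : E3 → ℝ≥0∞} (hf : IsPeriodic f) (y : E3) :
    ∫⁻ x, f (x - y) ∂torusMeasure = ∫⁻ x, f x ∂torusMeasure := by
  simpa only [sub_eq_add_neg] using lintegral_torus_comp_add hf (-y)

/-! ### Fubini for pairings with mollified fields. -/

namespace IsMollifier

variable {η : E3 → ℝ} {ε : ℝ} (hη : IsMollifier η ε)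
include hη

lemma integrable_inner_prod {u f : E3 → E3} (hu2 : MemLp u 2 torusMeasure)
    (hf : IsPeriodic f) (hf2 : MemLp f 2 torusMeasure) :
    Integrable (fun z : E3 × E3 => η z.2 * (inner ℝ (u z.1) (f (z.1 - z.2)) : ℝ))
      (torusMeasure.prod volume) := by
  have hint : Integrable f torusMeasure := hf2.integrable (by norm_num)
  have hu3 : ∫⁻ x, ‖u x‖ₑ ^ 2 ∂torusMeasure < ⊤ := by
    simpa using (eLpNorm_lt_top_iff_lintegral_rpow_enorm_lt_top (by norm_num) (by norm_num)).1 hu2.2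
  have hf3 : ∫⁻ x, ‖f x‖ₑ ^ 2 ∂torusMeasure < ⊤ := by
    simpa using (eLpNorm_lt_top_iff_lintegral_rpow_enorm_lt_top (by norm_num) (by norm_num)).1 hf2.2
  refine integrable_prod_of_slice_le (k := η)
    (M := ∫⁻ x, ‖u x‖ₑ ^ 2 ∂torusMeasure + ∫⁻ x, ‖f x‖ₑ ^ 2 ∂torusMeasure)
    ?_ hη.integrable (ENNReal.add_ne_top.2 ⟨hu3.ne, hf3.ne⟩) fun y => ?_
  · refine (hη.smooth.continuous.comp continuous_snd).aestronglyMeasurable.mul ?_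
    exact hu2.1.comp_fst.inner (hf.aestronglyMeasurable_sub_prod hint.1)
  · rw [← (hf.comp fun z => ‖z‖ₑ ^ 2).lintegral_comp_sub y,
      ← lintegral_add_left' (hu2.1.enorm.pow_const 2), ← lintegral_const_mul' _ _ (by simp)]
    refine lintegral_mono fun x => ?_
    simp only [enorm_mul]
    gcongr
    have h2 : ‖(inner ℝ (u x) (f (x - y)) : ℝ)‖ ≤ ‖u x‖ ^ 2 + ‖f (x - y)‖ ^ 2 :=
      (norm_inner_le_norm _ _).trans
        (by nlinarith [sq_nonneg (‖u x‖ - ‖f (x - y)‖), sq_nonneg (‖u x‖), sq_nonneg ‖f (x - y)‖])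
    simp only [← ofReal_norm]
    rw [← ENNReal.ofReal_pow (norm_nonneg _), ← ENNReal.ofReal_pow (norm_nonneg _),
      ← ENNReal.ofReal_add (by positivity) (by positivity)]
    exact ENNReal.ofReal_le_ofReal h2

lemma integral_inner_mollify {u f : E3 → E3} (hu2 : MemLp u 2 torusMeasure)
    (hf : IsPeriodic f) (hf2 : MemLp f 2 torusMeasure) :
    ∫ x, inner ℝ (u x) (mollify η f x) ∂torusMeasure =
      ∫ y, η y * ∫ x, inner ℝ (u x) (f (x - y)) ∂torusMeasure := by
  have hint : Integrable f torusMeasure := hf2.integrable (by norm_num)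
  have h1 : ∀ x, inner ℝ (u x) (mollify η f x) = ∫ y, η y * inner ℝ (u x) (f (x - y)) := by
    intro x
    rw [mollify_apply, ← integral_inner (hη.integrable_smul hf hint x)]
    simp [inner_smul_right]
  simp only [h1]
  rw [integral_integral_swap (hη.integrable_inner_prod hu2 hf hf2)]
  simp only [integral_const_mul]

lemma integrable_mul_integral_inner {u f : E3 → E3} (hu2 : MemLp u 2 torusMeasure)
    (hf : IsPeriodic f) (hf2 : MemLp f 2 torusMeasure) :
    Integrable (fun y => η y * ∫ x, (inner ℝ (u x) (f (x - y)) : ℝ) ∂torusMeasure) := by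
  simpa only [integral_const_mul] using (hη.integrable_inner_prod hu2 hf hf2).integral_prod_right

/-- Convolution with an even kernel is symmetric. -/
lemma integral_inner_mollify_comm {u f : E3 → E3} (hu : IsPeriodic u)
    (hu2 : MemLp u 2 torusMeasure) (hf : IsPeriodic f) (hf2 : MemLp f 2 torusMeasure) :
    ∫ x, inner ℝ (u x) (mollify η f x) ∂torusMeasure =
      ∫ x, inner ℝ (f x) (mollify η u x) ∂torusMeasure := by
  rw [hη.integral_inner_mollify hu2 hf hf2, hη.integral_inner_mollify hf2 hu hu2,
    ← integral_neg_eq_self]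
  congr 1 with y
  rw [hη.even]
  congr 1
  have := integral_torus_comp_sub (hu.comp₂ (hf.comp_sub_right (-y)) fun a b => (inner ℝ a b : ℝ)) y
  rw [← this]
  congr 1 with x
  rw [real_inner_comm]
  congr 2
  abel

lemma integral_clm_integral {G : E3 × E3 → E3}
    (hG : AEStronglyMeasurable G (torusMeasure.prod volume)) {M : ℝ≥0∞} (hM : M ≠ ⊤)
    (hGy : ∀ y, Integrable (fun x => G (x, y)) torusMeasure)
    (h : ∀ y, ∫⁻ x, ‖G (x, y)‖ₑ ∂torusMeasure ≤ M) :
    Integrable (fun y => fderiv ℝ η y (∫ x, G (x, y) ∂torusMeasure)) ∧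
    ∫ y, fderiv ℝ η y (∫ x, G (x, y) ∂torusMeasure) =
      ∫ x, (∫ y, fderiv ℝ η y (G (x, y))) ∂torusMeasure := by
  have h1 : ∀ y, fderiv ℝ η y (∫ x, G (x, y) ∂torusMeasure) =
      ∫ x, fderiv ℝ η y (G (x, y)) ∂torusMeasure := fun y =>
    (ContinuousLinearMap.integral_comp_comm _ (hGy y)).symm
  have h2 : Integrable (fun z : E3 × E3 => fderiv ℝ η z.2 (G z)) (torusMeasure.prod volume) := by
    refine integrable_prod_of_slice_le (k := fun y => ‖fderiv ℝ η y‖) (M := M) ?_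
      hη.integrable_fderiv.norm hM fun y => ?_
    · exact isBoundedBilinearMap_apply.continuous.comp_aestronglyMeasurable
        ((hη.continuous_fderiv.comp continuous_snd).aestronglyMeasurable.prodMk hG)
    · refine le_trans ?_ (mul_le_mul_right (h y) _)
      rw [← lintegral_const_mul' _ _ (by simp)]
      refine lintegral_mono fun x => ?_
      simpa using ContinuousLinearMap.le_opENorm (fderiv ℝ η y) (G (x, y))
  simp only [h1]
  exact ⟨h2.integral_prod_right, (integral_integral_swap (f := fun x y => fderiv ℝ η y (G (x, y))) h2).symm⟩

end IsMollifier

/-! ### The Duchon–Robert identity. -/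

/-- The energy flux `∫ v ⊗ v : ∇ w` through the smooth field `w`. -/
noncomputable def flux (v w : E3 → E3) : ℝ :=
  ∫ x, inner ℝ (v x) (fderiv ℝ w x (v x)) ∂torusMeasure

lemma sq_mul_le_cube_add_cube {a b : ℝ} (ha : 0 ≤ a) (hb : 0 ≤ b) : a ^ 2 * b ≤ a ^ 3 + b ^ 3 := by
  rcases le_total a b with h | h
  · have : a ^ 2 * b ≤ b ^ 2 * b := by gcongr
    nlinarith [pow_nonneg ha 3]
  · have : a ^ 2 * b ≤ a ^ 2 * a := by gcongr
    nlinarith [pow_nonneg hb 3]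

/-- With `a = v(x)` and `b = v(x - y)`, each bracket is antisymmetric under swapping `a` and `b`.
After integration in `x` the first bracket vanishes and the others become differences `G(y) -
G(-y)`. -/
lemma norm_sq_smul_sub (a b : E3) :
    ‖b - a‖ ^ 2 • (b - a) = (‖b‖ ^ 2 • b - ‖a‖ ^ 2 • a) + (‖a‖ ^ 2 • b - ‖b‖ ^ 2 • a)
      + (2 : ℝ) • ((inner ℝ a b : ℝ) • a - (inner ℝ a b : ℝ) • b) := by
  rw [norm_sub_sq_real, real_inner_comm]
  module

lemma lintegral_enorm_cube_lt_top {v : E3 → E3} (h3 : MemLp v 3 torusMeasure) :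
    ∫⁻ x, ‖v x‖ₑ ^ 3 ∂torusMeasure < ⊤ := by
  simpa using (eLpNorm_lt_top_iff_lintegral_rpow_enorm_lt_top (by norm_num) (by norm_num)).1 h3.2

/-- A pointwise cubic bound makes a function of `v(x)` and `v(x - y)` integrable, uniformly in
`y`. -/
lemma integrable_of_cubic_bound {v : E3 → E3} (hv : IsPeriodic v) (h3 : MemLp v 3 torusMeasure)
    {g : E3 × E3 → E3} (hg : Continuous g) (hb : ∀ a b, ‖g (a, b)‖ ≤ ‖a‖ ^ 3 + ‖b‖ ^ 3) :
    AEStronglyMeasurable (fun z : E3 × E3 => g (v z.1, v (z.1 - z.2))) (torusMeasure.prod volume) ∧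
    (∀ y, Integrable (fun x => g (v x, v (x - y))) torusMeasure) ∧
    ∀ y, ∫⁻ x, ‖g (v x, v (x - y))‖ₑ ∂torusMeasure ≤ 2 * ∫⁻ x, ‖v x‖ₑ ^ 3 ∂torusMeasure := by
  have hb2 : ∀ y, ∫⁻ x, ‖g (v x, v (x - y))‖ₑ ∂torusMeasure ≤
      2 * ∫⁻ x, ‖v x‖ₑ ^ 3 ∂torusMeasure := by
    intro y
    rw [two_mul]
    nth_rewrite 2 [← (hv.comp fun z => ‖z‖ₑ ^ 3).lintegral_comp_sub y]
    rw [← lintegral_add_left' (h3.1.enorm.pow_const 3)]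
    refine lintegral_mono fun x => ?_
    simp only [← ofReal_norm]
    rw [← ENNReal.ofReal_pow (norm_nonneg _), ← ENNReal.ofReal_pow (norm_nonneg _),
        ← ENNReal.ofReal_add (by positivity) (by positivity)]
    exact ENNReal.ofReal_le_ofReal (hb _ _)
  refine ⟨?_, fun y => ⟨?_, ?_⟩, hb2⟩
  · exact hg.comp_aestronglyMeasurable (h3.1.comp_fst.prodMk (hv.aestronglyMeasurable_sub_prod h3.1))
  · exact hg.comp_aestronglyMeasurable (h3.1.prodMk (hv.aestronglyMeasurable_comp_sub h3.1 y))
  · exact (hb2 y).trans_lt (ENNReal.mul_lt_top (by simp) (lintegral_enorm_cube_lt_top h3))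

/-- The Duchon–Robert identity for the flux of `v` through its own mollification. -/
lemma IsMollifier.flux_mollify_eq {η : E3 → ℝ} {ε : ℝ} (hη : IsMollifier η ε) {v : E3 → E3}
    (hv : IsPeriodic v) (h3 : MemLp v 3 torusMeasure) (hdiv : IsWeaklyDivFree v) :
    flux v (mollify η v) = (1 / 4) * ∫ y, fderiv ℝ η y
      (∫ x, ‖v (x - y) - v x‖ ^ 2 • (v (x - y) - v x) ∂torusMeasure) := by
  have hint : Integrable v torusMeasure := h3.integrable (by norm_num)
  have hM : 2 * ∫⁻ x, ‖v x‖ₑ ^ 3 ∂torusMeasure ≠ ⊤ :=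
    (ENNReal.mul_lt_top (by simp) (lintegral_enorm_cube_lt_top h3)).ne
  obtain ⟨hA1, hA2, hA3⟩ := integrable_of_cubic_bound hv h3 (g := fun p => ‖p.1‖ ^ 2 • p.2)
    (by fun_prop) fun a b => by
      simpa [norm_smul] using sq_mul_le_cube_add_cube (norm_nonneg a) (norm_nonneg b)
  obtain ⟨-, hB2, -⟩ := integrable_of_cubic_bound hv h3 (g := fun p => ‖p.2‖ ^ 2 • p.1)
    (by fun_prop) fun a b => by
      rw [add_comm]
      simpa [norm_smul] using sq_mul_le_cube_add_cube (norm_nonneg b) (norm_nonneg a)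
  obtain ⟨hC1, hC2, hC3⟩ := integrable_of_cubic_bound hv h3
    (g := fun p => (inner ℝ p.1 p.2 : ℝ) • p.1) (by fun_prop) fun a b => by
      rw [norm_smul]
      refine (mul_le_mul_of_nonneg_right (norm_inner_le_norm a b) (norm_nonneg a)).trans ?_
      exact le_trans (by ring_nf; rfl) (sq_mul_le_cube_add_cube (norm_nonneg a) (norm_nonneg b))
  obtain ⟨-, hD2, -⟩ := integrable_of_cubic_bound hv h3
    (g := fun p => (inner ℝ p.1 p.2 : ℝ) • p.2) (by fun_prop) fun a b => by
      rw [norm_smul, add_comm]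
      refine (mul_le_mul_of_nonneg_right (norm_inner_le_norm a b) (norm_nonneg b)).trans ?_
      exact le_trans (by ring_nf; rfl) (sq_mul_le_cube_add_cube (norm_nonneg b) (norm_nonneg a))
  obtain ⟨-, hE2, -⟩ := integrable_of_cubic_bound hv h3 (g := fun p => ‖p.1‖ ^ 2 • p.1)
    (by fun_prop) fun a b => by
      rw [norm_smul]
      simp only [norm_pow, norm_norm]
      nlinarith [pow_nonneg (norm_nonneg b) 3]
  obtain ⟨-, hE'2, -⟩ := integrable_of_cubic_bound hv h3 (g := fun p => ‖p.2‖ ^ 2 • p.2)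
    (by fun_prop) fun a b => by
      rw [norm_smul]
      simp only [norm_pow, norm_norm]
      nlinarith [pow_nonneg (norm_nonneg a) 3]
  set A : E3 → E3 := fun y => ∫ x, ‖v x‖ ^ 2 • v (x - y) ∂torusMeasure with hA
  set D : E3 → E3 := fun y => ∫ x, (inner ℝ (v x) (v (x - y)) : ℝ) • v x ∂torusMeasure with hD
  have hB : ∀ y, ∫ x, ‖v (x - y)‖ ^ 2 • v x ∂torusMeasure = A (-y) := by
    intro y
    change _ = ∫ x, ‖v x‖ ^ 2 • v (x - -y) ∂torusMeasure
    rw [← integral_torus_comp_sub (hv.comp₂ (hv.comp_sub_right (-y)) fun a b => ‖a‖ ^ 2 • b) y]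
    simp
  have hD' : ∀ y, ∫ x, (inner ℝ (v x) (v (x - y)) : ℝ) • v (x - y) ∂torusMeasure = D (-y) := by
    intro y
    change _ = ∫ x, (inner ℝ (v x) (v (x - -y)) : ℝ) • v x ∂torusMeasure
    rw [← integral_torus_comp_sub
      (hv.comp₂ (hv.comp_sub_right (-y)) fun a b => (inner ℝ a b : ℝ) • a) y]
    simp [real_inner_comm]
  have hJ : ∀ y, ∫ x, ‖v (x - y) - v x‖ ^ 2 • (v (x - y) - v x) ∂torusMeasure =
      (A y - A (-y)) + (2 : ℝ) • (D y - D (-y)) := by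
    intro y
    simp only [norm_sq_smul_sub]
    rw [integral_add, integral_add, integral_sub (hE'2 y) (hE2 y), integral_smul,
      integral_sub (hA2 y) (hB2 y), integral_sub (hC2 y) (hD2 y), hB, hD',
      integral_torus_comp_sub (hv.comp fun a => ‖a‖ ^ 2 • a) y]
    · simp [hA, hD]
    · exact (hE'2 y).sub (hE2 y)
    · exact (hA2 y).sub (hB2 y)
    · exact ((hE'2 y).sub (hE2 y)).add ((hA2 y).sub (hB2 y))
    · exact ((hC2 y).sub (hD2 y)).smul (2 : ℝ)
  obtain ⟨iA, eA⟩ := hη.integral_clm_integral hA1 hM hA2 hA3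
  obtain ⟨iD, eD⟩ := hη.integral_clm_integral hC1 hM hC2 hC3
  replace iA : Integrable fun y => fderiv ℝ η y (A y) := iA
  replace iD : Integrable fun y => fderiv ℝ η y (D y) := iD
  -- This term is `∫ |v|² div v_ε dx`.
  have hA0 : ∫ y, fderiv ℝ η y (A y) = 0 := by
    refine eA.trans (integral_eq_zero_of_ae (Eventually.of_forall fun x => ?_))
    simp only [map_smul, smul_eq_mul, Pi.zero_apply]
    rw [integral_const_mul, ← hη.divergence_mollify hv hint,
      hη.divergence_mollify_eq_zero hv hint hdiv, mul_zero]
  have hD0 : ∫ y, fderiv ℝ η y (D y) = flux v (mollify η v) := by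
    refine eD.trans ?_
    rw [flux]
    congr 1 with x
    rw [hη.fderiv_mollify_apply hv hint,
      ← integral_inner (hη.integrable_fderiv_smul hv hint x (v x))]
    congr 1 with y
    rw [map_smul, smul_eq_mul, inner_smul_right, mul_comm]
  -- The gradient of an even kernel is odd, so integrating `G(y) - G(-y)` against it doubles the
  -- integral of `G`. Together with the coefficient `2` of `D` this makes four times the flux.
  have hneg : ∀ G : E3 → E3, Integrable (fun y => fderiv ℝ η y (G y)) →
      Integrable (fun y => fderiv ℝ η y (G (-y))) ∧
      ∫ y, fderiv ℝ η y (G (-y)) = -∫ y, fderiv ℝ η y (G y) := by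
    intro G hG
    have h : (fun y => fderiv ℝ η y (G (-y))) = fun y => -(fderiv ℝ η (-y) (G (-y))) := by
      funext y
      rw [hη.fderiv_neg]
      simp
    rw [h]
    refine ⟨hG.comp_neg.neg, ?_⟩
    rw [integral_neg, integral_neg_eq_self fun y => fderiv ℝ η y (G y)]
  obtain ⟨iA', eA'⟩ := hneg A iA
  obtain ⟨iD', eD'⟩ := hneg D iD
  simp only [hJ, map_add, map_sub, map_smul, smul_eq_mul]
  rw [integral_add (f := fun y => fderiv ℝ η y (A y) - fderiv ℝ η y (A (-y)))
    (g := fun y => 2 * (fderiv ℝ η y (D y) - fderiv ℝ η y (D (-y)))) (iA.sub iA') ((iD.sub iD').const_mul 2), integral_sub iA iA', integral_const_mul,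
    integral_sub iD iD', eA', eD', hA0, hD0]
  ring

/-! ### Weak time derivatives -/

/-- The smooth step from `0` to `1` on the interval `[s, s + δ]`. -/
noncomputable def smoothStep (s δ τ : ℝ) : ℝ := Real.smoothTransition ((τ - s) / δ)

lemma contDiff_smoothStep (s δ : ℝ) : ContDiff ℝ ∞ (smoothStep s δ) :=
  Real.smoothTransition.contDiff.comp ((contDiff_id.sub contDiff_const).div_const δ)

lemma smoothStep_of_le {s δ τ : ℝ} (hδ : 0 < δ) (h : τ ≤ s) : smoothStep s δ τ = 0 :=
  Real.smoothTransition.zero_of_nonpos (div_nonpos_of_nonpos_of_nonneg (by linarith) hδ.le)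

lemma smoothStep_of_ge {s δ τ : ℝ} (hδ : 0 < δ) (h : s + δ ≤ τ) : smoothStep s δ τ = 1 :=
  Real.smoothTransition.one_of_one_le ((one_le_div hδ).2 (by linarith))

lemma smoothStep_mem (s δ τ : ℝ) : smoothStep s δ τ ∈ Icc (0 : ℝ) 1 :=
  ⟨Real.smoothTransition.nonneg _, Real.smoothTransition.le_one _⟩

lemma monotone_smoothStep {s δ : ℝ} (hδ : 0 < δ) : Monotone (smoothStep s δ) := fun a b hab =>
  Real.smoothTransition.monotone (by gcongr)

lemma deriv_smoothStep_eq_zero {s δ τ : ℝ} (hδ : 0 < δ) (h : τ ∉ Icc s (s + δ)) :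
    deriv (smoothStep s δ) τ = 0 := by
  rw [mem_Icc, not_and_or, not_le, not_le] at h
  rcases h with h | h
  · have : smoothStep s δ =ᶠ[𝓝 τ] fun _ => 0 := by
      filter_upwards [Iio_mem_nhds h] with x hx using smoothStep_of_le hδ (le_of_lt hx)
    rw [this.deriv_eq]
    simp
  · have : smoothStep s δ =ᶠ[𝓝 τ] fun _ => 1 := by
      filter_upwards [Ioi_mem_nhds h] with x hx using smoothStep_of_ge hδ (le_of_lt hx)
    rw [this.deriv_eq]
    simp

/-- The derivative of the step is a nonnegative kernel of mass one carried by `[s, s + δ]`, hence an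
approximate identity at `s`. -/
lemma tendsto_integral_deriv_smoothStep {T : ℝ} {F : ℝ → ℝ} (hF : ContinuousOn F (Icc 0 T)) {s : ℝ}
    (hs : s ∈ Ioo 0 T) :
    Tendsto (fun δ => ∫ τ in Ioo 0 T, deriv (smoothStep s δ) τ * F τ) (𝓝[>] 0) (𝓝 (F s)) := by
  have hT : 0 ≤ T := (hs.1.trans hs.2).le
  rw [Metric.tendsto_nhds]
  intro e he
  obtain ⟨δ₀, hδ₀, hF₀⟩ := Metric.continuousWithinAt_iff.1 (hF s ⟨hs.1.le, hs.2.le⟩) (e / 2)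
    (by positivity)
  filter_upwards [Ioo_mem_nhdsGT (lt_min hδ₀ (sub_pos.2 hs.2))] with δ hδ
  obtain ⟨hδ0, hδ1⟩ := hδ
  rw [lt_min_iff] at hδ1
  have hc : Continuous (deriv (smoothStep s δ)) :=
    (contDiff_smoothStep s δ).continuous_deriv (by simp)
  have hk0 : ∀ τ, 0 ≤ deriv (smoothStep s δ) τ := fun τ =>
    (monotone_smoothStep hδ0).deriv_nonneg
  have hki : IntegrableOn (deriv (smoothStep s δ)) (Ioo 0 T) :=
    (hc.integrableOn_Icc).mono_set Ioo_subset_Icc_self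
  have hkF : IntegrableOn (fun τ => deriv (smoothStep s δ) τ * F τ) (Ioo 0 T) :=
    ((hc.continuousOn.mul hF).integrableOn_Icc).mono_set Ioo_subset_Icc_self
  have h1 : ∫ τ in Ioo 0 T, deriv (smoothStep s δ) τ = 1 := by
    rw [← integral_Ioc_eq_integral_Ioo, ← intervalIntegral.integral_of_le hT,
      intervalIntegral.integral_deriv_eq_sub
        (fun x _ => ((contDiff_smoothStep s δ).differentiable (by simp)) x)
        (hc.intervalIntegrable _ _),
      smoothStep_of_ge hδ0 (by linarith), smoothStep_of_le hδ0 hs.1.le, sub_zero]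
  have h2 : (∫ τ in Ioo 0 T, deriv (smoothStep s δ) τ * F τ) - F s =
      ∫ τ in Ioo 0 T, deriv (smoothStep s δ) τ * (F τ - F s) := by
    simp only [mul_sub]
    rw [integral_sub hkF (hki.mul_const _), integral_mul_const, h1, one_mul]
  rw [Real.dist_eq, h2]
  refine lt_of_le_of_lt ?_ (half_lt_self he)
  calc |∫ τ in Ioo 0 T, deriv (smoothStep s δ) τ * (F τ - F s)|
      ≤ ∫ τ in Ioo 0 T, deriv (smoothStep s δ) τ * (e / 2) := by
        rw [← Real.norm_eq_abs]
        refine norm_integral_le_of_norm_le (hki.mul_const _) ?_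
        refine (ae_restrict_iff' measurableSet_Ioo).2 (Eventually.of_forall fun τ hτ => ?_)
        rw [norm_mul, Real.norm_of_nonneg (hk0 τ)]
        by_cases hm : τ ∈ Icc s (s + δ)
        · refine mul_le_mul_of_nonneg_left ?_ (hk0 τ)
          refine (hF₀ ⟨hτ.1.le, hτ.2.le⟩ ?_).le
          rw [Real.dist_eq, abs_lt]
          constructor <;> linarith [hm.1, hm.2, hδ1.1]
        · simp [deriv_smoothStep_eq_zero hδ0 hm]
    _ = e / 2 := by rw [integral_mul_const, h1, one_mul]

lemma tendsto_integral_smoothStep_sub {T : ℝ} {g : ℝ → ℝ} (hg : IntegrableOn g (Ioo 0 T))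
    {s t : ℝ} (hs : 0 ≤ s) (ht : t < T) (hst : s ≤ t) :
    Tendsto (fun δ => ∫ τ in Ioo 0 T, (smoothStep s δ τ - smoothStep t δ τ) * g τ) (𝓝[>] 0)
      (𝓝 (∫ τ in s..t, g τ)) := by
  have h1 : ∫ τ in s..t, g τ = ∫ τ in Ioo 0 T, (Ioc s t).indicator g τ := by
    rw [intervalIntegral.integral_of_le hst, setIntegral_indicator measurableSet_Ioc,
      inter_eq_right.2 (show Ioc s t ⊆ Ioo 0 T from
        fun x hx => ⟨hs.trans_lt hx.1, hx.2.trans_lt ht⟩)]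
  rw [h1]
  refine tendsto_integral_filter_of_dominated_convergence (fun τ => ‖g τ‖) ?_ ?_ hg.norm ?_
  · exact Eventually.of_forall fun δ => ((contDiff_smoothStep s δ).continuous.sub
      (contDiff_smoothStep t δ).continuous).aestronglyMeasurable.mul hg.1
  · refine Eventually.of_forall fun δ => Eventually.of_forall fun τ => ?_
    rw [norm_mul]
    refine mul_le_of_le_one_left (norm_nonneg _) ?_
    have h2 := smoothStep_mem s δ τ
    have h3 := smoothStep_mem t δ τ
    rw [Real.norm_eq_abs, abs_le]
    constructor <;> linarith [h2.1, h2.2, h3.1, h3.2]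
  · refine Eventually.of_forall fun τ => tendsto_nhds_of_eventually_eq ?_
    have h0 : ∀ᶠ δ : ℝ in 𝓝[>] 0, 0 < δ := self_mem_nhdsWithin
    rcases le_or_gt τ s with h | h
    · filter_upwards [h0] with δ hδ
      rw [smoothStep_of_le hδ h, smoothStep_of_le hδ (h.trans hst), indicator_of_notMem]
      · simp
      · exact fun hx => absurd hx.1 (not_lt.2 h)
    rcases le_or_gt τ t with h' | h'
    · filter_upwards [h0, Ioo_mem_nhdsGT (sub_pos.2 h)] with δ hδ hδ'
      rw [smoothStep_of_ge hδ (by linarith [hδ'.2]), smoothStep_of_le hδ h',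
        indicator_of_mem (show τ ∈ Ioc s t from ⟨h, h'⟩)]
      simp
    · filter_upwards [h0, Ioo_mem_nhdsGT (sub_pos.2 h), Ioo_mem_nhdsGT (sub_pos.2 h')]
        with δ hδ hδ1 hδ2
      rw [smoothStep_of_ge hδ (by linarith [hδ1.2]), smoothStep_of_ge hδ (by linarith [hδ2.2]),
        indicator_of_notMem]
      · simp
      · exact fun hx => absurd hx.2 (not_le.2 h')

/-- A continuous function on `[0, T]` with an integrable distributional derivative is a
primitive of it. -/
lemma sub_eq_integral_of_weak_deriv {T : ℝ} (hT : 0 < T) {f g : ℝ → ℝ}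
    (hf : ContinuousOn f (Icc 0 T)) (hg : IntegrableOn g (Ioo 0 T))
    (h : ∀ χ : ℝ → ℝ, ContDiff ℝ ∞ χ →
      (∃ a b : ℝ, 0 < a ∧ b < T ∧ ∀ t, t ∉ Icc a b → χ t = 0) →
      ∫ t in Ioo 0 T, (deriv χ t * f t + χ t * g t) = 0)
    {s t : ℝ} (hs : s ∈ Icc 0 T) (ht : t ∈ Icc 0 T) : f t - f s = ∫ τ in s..t, g τ := by
  have hgI : IntegrableOn g (Icc 0 T) := by
    rwa [integrableOn_Icc_iff_integrableOn_Ioo]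
  have hgi : ∀ {a b : ℝ}, a ∈ Icc 0 T → b ∈ Icc 0 T → IntervalIntegrable g volume a b :=
    fun ha hb => (hgI.mono_set (ordConnected_Icc.uIcc_subset ha hb)).intervalIntegrable
  have open_case : ∀ s t : ℝ, s ∈ Ioo 0 T → t ∈ Ioo 0 T → s ≤ t → f t - f s = ∫ τ in s..t, g τ := by
    intro s t hs ht hst
    have l1 := (tendsto_integral_deriv_smoothStep hf hs).sub (tendsto_integral_deriv_smoothStep hf ht)
    have l2 := (tendsto_integral_smoothStep_sub hg hs.1.le ht.2 hst).neg
    have h3 : -(∫ τ in s..t, g τ) = f s - f t := by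
      refine tendsto_nhds_unique_of_eventuallyEq l2 l1 ?_
      filter_upwards [Ioo_mem_nhdsGT (sub_pos.2 ht.2)] with δ hδ
      have hδ0 := hδ.1
      have hcd : ∀ s, Differentiable ℝ (smoothStep s δ) := fun s =>
        (contDiff_smoothStep s δ).differentiable (by simp)
      have hc : ∀ s, Continuous (deriv (smoothStep s δ)) := fun s =>
        (contDiff_smoothStep s δ).continuous_deriv (by simp)
      have i1 : ∀ s, IntegrableOn (fun τ => deriv (smoothStep s δ) τ * f τ) (Ioo 0 T) := fun s =>
        (((hc s).continuousOn.mul hf).integrableOn_Icc).mono_set Ioo_subset_Icc_self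
      have i2 : IntegrableOn (fun τ => (smoothStep s δ τ - smoothStep t δ τ) * g τ) (Ioo 0 T) := by
        refine Integrable.mono hg ((((contDiff_smoothStep s δ).continuous.sub
          (contDiff_smoothStep t δ).continuous).aestronglyMeasurable).mul hg.1)
          (Eventually.of_forall fun τ => ?_)
        rw [norm_mul]
        refine mul_le_of_le_one_left (norm_nonneg _) ?_
        have h2 := smoothStep_mem s δ τ
        have h3 := smoothStep_mem t δ τ
        rw [Real.norm_eq_abs, abs_le]
        constructor <;> linarith [h2.1, h2.2, h3.1, h3.2]
      have hd : ∀ τ, deriv (fun τ => smoothStep s δ τ - smoothStep t δ τ) τ =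
          deriv (smoothStep s δ) τ - deriv (smoothStep t δ) τ := fun τ =>
        deriv_fun_sub (hcd s τ) (hcd t τ)
      -- The test function is a smoothed indicator of `(s, t]`, supported in `[s, t + δ]`; `δ < T -
      -- t` keeps this inside `(0, T)`.
      have h4 := h (fun τ => smoothStep s δ τ - smoothStep t δ τ)
        ((contDiff_smoothStep s δ).sub (contDiff_smoothStep t δ))
        ⟨s, t + δ, hs.1, by linarith [hδ.2], fun τ hτ => by
          rw [mem_Icc, not_and_or, not_le, not_le] at hτ
          rcases hτ with hτ | hτ
          · rw [smoothStep_of_le hδ0 hτ.le, smoothStep_of_le hδ0 (hτ.le.trans hst), sub_zero]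
          · rw [smoothStep_of_ge hδ0 hτ.le, smoothStep_of_ge hδ0 (by linarith), sub_self]⟩
      simp only [hd, sub_mul] at h4 i2 ⊢
      have i3 : IntegrableOn (fun τ => deriv (smoothStep s δ) τ * f τ -
          deriv (smoothStep t δ) τ * f τ) (Ioo 0 T) := (i1 s).sub (i1 t)
      rw [integral_add i3 i2, integral_sub (i1 s) (i1 t)] at h4
      linarith
    linarith
  have hcont : ContinuousOn (fun t => f t - ∫ τ in (0 : ℝ)..t, g τ) (Icc 0 T) := by
    refine hf.sub ?_
    have := intervalIntegral.continuousOn_primitive_interval (f := g) (a := 0) (b := T) (μ := volume)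
      (by rwa [uIcc_of_le hT.le])
    rwa [uIcc_of_le hT.le] at this
  have hmem0 : (0 : ℝ) ∈ Icc 0 T := ⟨le_rfl, hT.le⟩
  have hhalf : T / 2 ∈ Ioo 0 T := ⟨by linarith, by linarith⟩
  have hconst : EqOn (fun t => f t - ∫ τ in (0 : ℝ)..t, g τ)
      (fun _ => f (T / 2) - ∫ τ in (0 : ℝ)..(T / 2), g τ) (Icc 0 T) := by
    refine EqOn.of_subset_closure (s := Ioo 0 T) ?_ hcont continuousOn_const Ioo_subset_Icc_self
      (by rw [closure_Ioo hT.ne])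
    intro t ht
    have hI := Ioo_subset_Icc_self (α := ℝ) (a := 0) (b := T)
    dsimp only
    rcases le_total t (T / 2) with hle | hle
    · have h1 := open_case t (T / 2) ht hhalf hle
      have h2 := intervalIntegral.integral_add_adjacent_intervals (hgi hmem0 (hI ht))
        (hgi (hI ht) (hI hhalf))
      linarith
    · have h1 := open_case (T / 2) t hhalf ht hle
      have h2 := intervalIntegral.integral_add_adjacent_intervals (hgi hmem0 (hI hhalf))
        (hgi (hI hhalf) (hI ht))
      linarith
  have h1 := hconst hs
  have h2 := hconst ht
  have h3 := intervalIntegral.integral_add_adjacent_intervals (hgi hmem0 hs) (hgi hs ht)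
  dsimp only at h1 h2
  linarith

/-! ### Weak solutions at fixed times -/

/-- The `L²` norm on the torus. -/
noncomputable def l2norm (f : E3 → E3) : ℝ := (eLpNorm f 2 torusMeasure).toReal

lemma l2norm_nonneg (f : E3 → E3) : 0 ≤ l2norm f := ENNReal.toReal_nonneg

lemma integral_inner_eq {f g : E3 → E3} (hf : MemLp f 2 torusMeasure) (hg : MemLp g 2 torusMeasure) :
    ∫ x, (inner ℝ (f x) (g x) : ℝ) ∂torusMeasure = inner ℝ (hf.toLp f) (hg.toLp g) := by
  rw [L2.inner_def]
  refine integral_congr_ae ?_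
  filter_upwards [hf.coeFn_toLp, hg.coeFn_toLp] with x h1 h2
  rw [h1, h2]

lemma integrable_inner {f g : E3 → E3} (hf : MemLp f 2 torusMeasure) (hg : MemLp g 2 torusMeasure) :
    Integrable (fun x => (inner ℝ (f x) (g x) : ℝ)) torusMeasure := by
  refine (L2.integrable_inner (𝕜 := ℝ) (hf.toLp f) (hg.toLp g)).congr ?_
  filter_upwards [hf.coeFn_toLp, hg.coeFn_toLp] with x h1 h2
  rw [h1, h2]

lemma abs_integral_inner_le {f g : E3 → E3} (hf : MemLp f 2 torusMeasure)
    (hg : MemLp g 2 torusMeasure) :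
    |∫ x, (inner ℝ (f x) (g x) : ℝ) ∂torusMeasure| ≤ l2norm f * l2norm g := by
  rw [integral_inner_eq hf hg]
  refine (abs_real_inner_le_norm _ _).trans ?_
  rw [Lp.norm_toLp, Lp.norm_toLp]
  rfl

lemma integral_norm_sq_eq {f : E3 → E3} (hf : MemLp f 2 torusMeasure) :
    ∫ x, ‖f x‖ ^ 2 ∂torusMeasure = l2norm f ^ 2 := by
  have h := integral_inner_eq hf hf
  simp only [real_inner_self_eq_norm_sq, Lp.norm_toLp] at h
  exact h

lemma IsPeriodic.memLp_of_continuous {f : E3 → E3} (hf : IsPeriodic f) (h : Continuous f)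
    (p : ℝ≥0∞) : MemLp f p torusMeasure := by
  obtain ⟨M, _, hM⟩ := hf.exists_bound h
  exact MemLp.of_bound h.aestronglyMeasurable M (Eventually.of_forall hM)

lemma IsWeakEulerSolution.integrableOn_flux {T : ℝ} {v : ℝ → E3 → E3}
    (hE : IsWeakEulerSolution T v) {w : E3 → E3} (hw : ContDiff ℝ ∞ w) (hwp : IsPeriodic w) :
    IntegrableOn (fun t => flux (v t) w) (Icc 0 T) := by
  have hc : Continuous (fderiv ℝ w) := hw.continuous_fderiv (by simp)
  obtain ⟨M, hM0, hM⟩ := hwp.fderiv.exists_bound hc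
  have h2 : Integrable (fun z : ℝ × E3 => ‖v z.1 z.2‖ ^ 2)
      ((volume.restrict (Icc 0 T)).prod torusMeasure) := hE.memL2.integrable_norm_pow (by simp)
  have h3 : Integrable (fun z : ℝ × E3 => inner ℝ (v z.1 z.2) (fderiv ℝ w z.2 (v z.1 z.2)))
      ((volume.restrict (Icc 0 T)).prod torusMeasure) := by
    refine (h2.const_mul M).mono' (hE.memL2.1.inner ?_) (Eventually.of_forall fun z => ?_)
    · exact isBoundedBilinearMap_apply.continuous.comp_aestronglyMeasurable
        ((hc.comp continuous_snd).aestronglyMeasurable.prodMk hE.memL2.1)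
    · refine (norm_inner_le_norm _ _).trans ?_
      have := (fderiv ℝ w z.2).le_of_opNorm_le (hM z.2) (v z.1 z.2)
      nlinarith [norm_nonneg (v z.1 z.2)]
  exact h3.integral_prod_left

lemma integrable_flux {u w : E3 → E3} (hu : MemLp u 2 torusMeasure) (hw : ContDiff ℝ ∞ w)
    (hwp : IsPeriodic w) :
    Integrable (fun x => (inner ℝ (u x) (fderiv ℝ w x (u x)) : ℝ)) torusMeasure := by
  have hc : Continuous (fderiv ℝ w) := hw.continuous_fderiv (by simp)
  obtain ⟨M, hM0, hM⟩ := hwp.fderiv.exists_bound hc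
  have h2 : Integrable (fun x => ‖u x‖ ^ 2) torusMeasure := hu.integrable_norm_pow (by simp)
  refine (h2.const_mul M).mono' (hu.1.inner ?_) (Eventually.of_forall fun x => ?_)
  · exact isBoundedBilinearMap_apply.continuous.comp_aestronglyMeasurable
        (hc.aestronglyMeasurable.prodMk hu.1)
  · refine (norm_inner_le_norm _ _).trans ?_
    have := (fderiv ℝ w x).le_of_opNorm_le (hM x) (u x)
    nlinarith [norm_nonneg (u x)]

section

variable {T : ℝ} {v : ℝ → E3 → E3} (hcont : ContinuousInL2 T v)
include hcont

lemma ContinuousInL2.tendsto_l2norm {t₀ : ℝ} (ht₀ : t₀ ∈ Icc 0 T) :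
    Tendsto (fun t => l2norm (fun x => v t x - v t₀ x)) (𝓝[Icc 0 T] t₀) (𝓝 0) := by
  exact (ENNReal.tendsto_toReal ENNReal.zero_ne_top).comp (hcont.2 t₀ ht₀)

lemma ContinuousInL2.continuousOn_integral_inner {w : E3 → E3} (hw : MemLp w 2 torusMeasure) :
    ContinuousOn (fun t => ∫ x, (inner ℝ (v t x) (w x) : ℝ) ∂torusMeasure) (Icc 0 T) := by
  intro t₀ ht₀
  refine tendsto_iff_norm_sub_tendsto_zero.2 ?_
  refine squeeze_zero' (Eventually.of_forall fun _ => norm_nonneg _) ?_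
    (by simpa using (hcont.tendsto_l2norm ht₀).mul_const (l2norm w))
  filter_upwards [self_mem_nhdsWithin] with t ht
  rw [← integral_sub (integrable_inner (hcont.1 t ht) hw) (integrable_inner (hcont.1 t₀ ht₀) hw)]
  simp only [← inner_sub_left]
  exact abs_integral_inner_le ((hcont.1 t ht).sub (hcont.1 t₀ ht₀)) hw

lemma ContinuousInL2.continuousOn_l2norm : ContinuousOn (fun t => l2norm (v t)) (Icc 0 T) := by
  intro t₀ ht₀
  refine tendsto_iff_norm_sub_tendsto_zero.2 ?_
  refine squeeze_zero' (Eventually.of_forall fun _ => norm_nonneg _) ?_ (hcont.tendsto_l2norm ht₀)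
  filter_upwards [self_mem_nhdsWithin] with t ht
  have h1 := hcont.1 t ht
  have h2 := hcont.1 t₀ ht₀
  have h3 := abs_norm_sub_norm_le (h1.toLp (v t)) (h2.toLp (v t₀))
  rw [← MemLp.toLp_sub, Lp.norm_toLp, Lp.norm_toLp, Lp.norm_toLp] at h3
  exact h3

lemma ContinuousInL2.continuousOn_kineticEnergy : ContinuousOn (kineticEnergy v) (Icc 0 T) := by
  refine ContinuousOn.congr (f := fun t => (1 / 2) * l2norm (v t) ^ 2)
    (continuousOn_const.mul (hcont.continuousOn_l2norm.pow 2)) fun t ht => ?_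
  rw [kineticEnergy, integral_norm_sq_eq (hcont.1 t ht)]

lemma ContinuousInL2.exists_bound : ∃ M, 0 ≤ M ∧ ∀ t ∈ Icc 0 T, l2norm (v t) ≤ M := by
  obtain ⟨M, hM⟩ := isCompact_Icc.exists_bound_of_continuousOn hcont.continuousOn_l2norm
  exact ⟨max M 0, le_max_right _ _, fun t ht => ((le_abs_self _).trans (hM t ht)).trans
    (le_max_left _ _)⟩

variable (hT : 0 < T) (hE : IsWeakEulerSolution T v)
include hT hE

/-- Test functions `χ(t) ψ(x)` show that the pairing with `∇ψ` vanishes weakly in time. It is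
continuous in time, so it vanishes at every time. -/
lemma IsWeakEulerSolution.isWeaklyDivFree {t : ℝ} (ht : t ∈ Icc 0 T) : IsWeaklyDivFree (v t) := by
  intro ψ hψ hψp
  have hgc : Continuous (gradient ψ) :=
    (InnerProductSpace.toDual ℝ E3).symm.continuous.comp (hψ.continuous_fderiv (by simp))
  have hgp : IsPeriodic (gradient ψ) := hψp.fderiv.comp (InnerProductSpace.toDual ℝ E3).symm
  have hg2 := hgp.memLp_of_continuous hgc 2
  have hin : ∀ x u, fderiv ℝ ψ x u = inner ℝ u (gradient ψ x) := by
    intro x u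
    rw [real_inner_comm, gradient, InnerProductSpace.toDual_symm_apply]
  have hac : ContinuousOn (fun t => ∫ x, fderiv ℝ ψ x (v t x) ∂torusMeasure) (Icc 0 T) := by
    simp only [hin]
    exact hcont.continuousOn_integral_inner hg2
  have hprim : ∀ s ∈ Icc 0 T, ∀ t ∈ Icc 0 T,
      ∫ τ in s..t, ∫ x, fderiv ℝ ψ x (v τ x) ∂torusMeasure = 0 := by
    intro s hs t ht
    -- The pairing is a weak derivative of the zero function, so its integral over every interval is
    -- zero.
    rw [← sub_eq_integral_of_weak_deriv hT (f := fun _ => 0) continuousOn_const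
      (hac.integrableOn_Icc.mono_set Ioo_subset_Icc_self) ?_ hs ht, sub_self]
    intro χ hχ hsupp
    have h1 := hE.divergenceFree (fun t x => χ t * ψ x)
      ⟨(hχ.comp contDiff_fst).mul (hψ.comp contDiff_snd), fun t => hψp.comp _, by
        obtain ⟨a, b, ha, hb, hab⟩ := hsupp
        exact ⟨a, b, ha, hb, fun t ht x => by rw [hab t ht, zero_mul]⟩⟩
    refine Eq.trans (integral_congr_ae (Eventually.of_forall fun t => ?_)) h1
    dsimp only
    rw [mul_zero, zero_add, ← integral_const_mul]
    congr 1 with x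
    rw [fderiv_const_mul (hψ.differentiable (by simp) x)]
    simp
  have hopen : EqOn (fun t => ∫ x, fderiv ℝ ψ x (v t x) ∂torusMeasure) (fun _ => 0) (Icc 0 T) := by
    refine EqOn.of_subset_closure (s := Ioo 0 T) ?_ hac continuousOn_const Ioo_subset_Icc_self
      (by rw [closure_Ioo hT.ne])
    intro t ht
    have hmem : Icc 0 T ∈ 𝓝 t := Icc_mem_nhds ht.1 ht.2
    have h0 : (0 : ℝ) ∈ Icc 0 T := ⟨le_rfl, hT.le⟩
    have h1 : HasDerivAt (fun u => ∫ τ in (0 : ℝ)..u, ∫ x, fderiv ℝ ψ x (v τ x) ∂torusMeasure)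
        (∫ x, fderiv ℝ ψ x (v t x) ∂torusMeasure) t := by
      refine intervalIntegral.integral_hasDerivAt_right ?_ ?_ (hac.continuousAt hmem)
      · exact (hac.mono (ordConnected_Icc.uIcc_subset h0
          (Ioo_subset_Icc_self ht))).intervalIntegrable
      · exact ⟨Icc 0 T, hmem, hac.aestronglyMeasurable measurableSet_Icc⟩
    have h2 : (fun u => ∫ τ in (0 : ℝ)..u, ∫ x, fderiv ℝ ψ x (v τ x) ∂torusMeasure) =ᶠ[𝓝 t]
        fun _ => 0 := by
      filter_upwards [hmem] with u hu using hprim 0 h0 u hu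
    exact (h1.congr_of_eventuallyEq h2.symm).unique (hasDerivAt_const _ _)
  exact hopen ht

/-- Testing with `χ(t) w(x)` identifies the flux as the weak derivative of the continuous function
`t ↦ ∫ v(t) · w`. The limits may be any times in `[0, T]`, endpoints included. -/
lemma IsWeakEulerSolution.integral_inner_sub {w : E3 → E3} (hw : ContDiff ℝ ∞ w)
    (hwp : IsPeriodic w) (hdiv : ∀ x, divergence w x = 0) {s t : ℝ} (hs : s ∈ Icc 0 T)
    (ht : t ∈ Icc 0 T) :
    ∫ x, (inner ℝ (v t x) (w x) : ℝ) ∂torusMeasure - ∫ x, (inner ℝ (v s x) (w x) : ℝ) ∂torusMeasure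
      = ∫ τ in s..t, flux (v τ) w := by
  have hw2 := hwp.memLp_of_continuous hw.continuous 2
  refine sub_eq_integral_of_weak_deriv hT (hcont.continuousOn_integral_inner hw2)
    ((hE.integrableOn_flux hw hwp).mono_set Ioo_subset_Icc_self) ?_ hs ht
  intro χ hχ hsupp
  have hdw := hw.differentiable (by simp)
  have hfd : ∀ (t : ℝ) (x : E3), fderiv ℝ (fun y => χ t • w y) x = χ t • fderiv ℝ w x := fun t x =>
    fderiv_const_smul (hdw x) (χ t)
  have h1 := hE.momentum (fun t x => χ t • w x)
    ⟨(hχ.comp contDiff_fst).smul (hw.comp contDiff_snd), fun t => hwp.comp _, by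
        obtain ⟨a, b, ha, hb, hab⟩ := hsupp
        exact ⟨a, b, ha, hb, fun t ht x => by rw [hab t ht, zero_smul]⟩⟩ fun t x => by
      have := hdiv x
      simp only [divergence] at this ⊢
      simp [hfd, ← Finset.mul_sum, this]
  refine Eq.trans (setIntegral_congr_fun measurableSet_Ioo fun t ht => ?_) h1
  have hvt := hcont.1 t (Ioo_subset_Icc_self ht)
  have hd : ∀ x, deriv (fun s => χ s • w x) t = deriv χ t • w x := fun x =>
    deriv_smul_const (hχ.differentiable (by simp) t) (w x)
  simp only [hfd, hd, inner_smul_right, _root_.smul_apply]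
  rw [integral_add ((integrable_inner hvt hw2).const_mul _)
    ((integrable_flux hvt hw hwp).const_mul _), integral_const_mul, integral_const_mul]
  rfl

end

/-! ### The energy balance of the mollified solution -/

/-- Steps of length `δ / 2` chain the short-time bound. It is needed because the energy estimate is
first available only on intervals where `v` barely moves in `L²`. -/
lemma enorm_sub_le_lintegral_of_local {T δ : ℝ} (hδ : 0 < δ) {E : ℝ → ℝ} {P : ℝ → ℝ≥0∞}
    (h : ∀ s ∈ Icc 0 T, ∀ t ∈ Icc 0 T, s ≤ t → t - s < δ →
      ‖E t - E s‖ₑ ≤ ∫⁻ τ in Ioc s t, P τ) {t : ℝ} (ht : t ∈ Icc 0 T) :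
    ‖E t - E 0‖ₑ ≤ ∫⁻ τ in Ioc 0 t, P τ := by
  have key : ∀ (n : ℕ), ∀ t ∈ Icc 0 T, t < n * (δ / 2) → ‖E t - E 0‖ₑ ≤ ∫⁻ τ in Ioc 0 t, P τ := by
    intro n
    induction n with
    | zero => intro t ht h; simp at h; linarith [ht.1]
    | succ n ih =>
      intro t ht hlt
      push_cast at hlt
      have h0 : (0 : ℝ) ∈ Icc 0 T := ⟨le_rfl, ht.1.trans ht.2⟩
      rcases lt_or_ge t (δ / 2) with h1 | h1
      · exact h 0 h0 t ht ht.1 (by linarith)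
      · have hs : t - δ / 2 ∈ Icc 0 T := ⟨by linarith, by linarith [ht.2]⟩
        have h2 := ih _ hs (by linarith)
        have h3 := h _ hs t ht (by linarith) (by linarith)
        rw [← Ioc_union_Ioc_eq_Ioc hs.1 (by linarith : t - δ / 2 ≤ t),
          lintegral_union measurableSet_Ioc (Ioc_disjoint_Ioc_of_le le_rfl)]
        calc ‖E t - E 0‖ₑ = ‖(E (t - δ / 2) - E 0) + (E t - E (t - δ / 2))‖ₑ := by congr 1; ring
          _ ≤ _ := (enorm_add_le _ _).trans (add_le_add h2 h3)
  obtain ⟨n, hn⟩ := exists_nat_gt (t / (δ / 2))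
  exact key n t ht ((div_lt_iff₀ (by positivity)).1 hn)

lemma ContinuousInL2.uniform {T : ℝ} {v : ℝ → E3 → E3} (hcont : ContinuousInL2 T v) {e : ℝ}
    (he : 0 < e) : ∃ δ > 0, ∀ s ∈ Icc 0 T, ∀ t ∈ Icc 0 T, |t - s| < δ →
      l2norm (fun x => v t x - v s x) < e := by
  classical
  set V : ℝ → Lp E3 2 torusMeasure :=
    fun t => if h : t ∈ Icc 0 T then (hcont.1 t h).toLp (v t) else 0 with hV
  have hdist : ∀ s ∈ Icc 0 T, ∀ t ∈ Icc 0 T,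
      dist (V t) (V s) = l2norm (fun x => v t x - v s x) := by
    intro s hs t ht
    rw [dist_eq_norm, hV]
    simp only [hs, ht, dif_pos]
    rw [← MemLp.toLp_sub, Lp.norm_toLp]
    rfl
  have hVc : ContinuousOn V (Icc 0 T) := by
    intro t₀ ht₀
    refine tendsto_iff_dist_tendsto_zero.2 ((hcont.tendsto_l2norm ht₀).congr' ?_)
    filter_upwards [self_mem_nhdsWithin] with t ht using (hdist _ ht₀ _ ht).symm
  obtain ⟨δ, hδ, h⟩ := Metric.uniformContinuousOn_iff.1
    (isCompact_Icc.uniformContinuousOn_of_continuous hVc) e he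
  refine ⟨δ, hδ, fun s hs t ht hst => ?_⟩
  rw [← hdist s hs t ht]
  exact h t ht s hs hst

lemma integral_norm_le_l2norm {f : E3 → E3} (hf : MemLp f 2 torusMeasure) :
    ∫ x, ‖f x‖ ∂torusMeasure ≤ l2norm f := by
  rw [integral_norm_eq_lintegral_enorm hf.1, ← eLpNorm_one_eq_lintegral_enorm]
  exact ENNReal.toReal_mono hf.2.ne (eLpNorm_le_eLpNorm_of_exponent_le (by norm_num) hf.1)

namespace IsMollifier

variable {η : E3 → ℝ} {ε : ℝ} (hη : IsMollifier η ε)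
include hη

lemma mollify_sub {f g : E3 → E3} (hf : IsPeriodic f) (hfi : Integrable f torusMeasure)
    (hg : IsPeriodic g) (hgi : Integrable g torusMeasure) (x : E3) :
    mollify η f x - mollify η g x = mollify η (fun x => f x - g x) x := by
  rw [mollify_apply, mollify_apply, mollify_apply,
    ← integral_sub (hη.integrable_smul hf hfi x) (hη.integrable_smul hg hgi x)]
  simp only [smul_sub]

/-- This is the price of exchanging the frozen field for the moving one. The constant `K` depends on
the kernel, which is harmless because the `L²` difference tends to zero with the kernel fixed. -/
lemma abs_flux_sub_le (hε : ε < 1 / 2) {K : ℝ} (hK : ∀ y, ‖fderiv ℝ η y‖ ≤ K) {u f g : E3 → E3}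
    (hu : MemLp u 2 torusMeasure) (hf : IsPeriodic f) (hf2 : MemLp f 2 torusMeasure)
    (hg : IsPeriodic g) (hg2 : MemLp g 2 torusMeasure) :
    |flux u (mollify η f) - flux u (mollify η g)| ≤
      K * l2norm (fun x => f x - g x) * l2norm u ^ 2 := by
  have hfi : Integrable f torusMeasure := hf2.integrable (by norm_num)
  have hgi : Integrable g torusMeasure := hg2.integrable (by norm_num)
  have hK0 : 0 ≤ K := (norm_nonneg _).trans (hK 0)
  have hsf := hη.contDiff_mollify hf hfi
  have hsg := hη.contDiff_mollify hg hgi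
  have hd : ∀ x, fderiv ℝ (mollify η f) x - fderiv ℝ (mollify η g) x =
      fderiv ℝ (mollify η (fun x => f x - g x)) x := by
    intro x
    rw [← fderiv_fun_sub (hsf.differentiable (by simp) x) (hsg.differentiable (by simp) x)]
    simp only [hη.mollify_sub hf hfi hg hgi]
  rw [flux, flux, ← integral_sub (integrable_flux hu hsf hf.mollify)
    (integrable_flux hu hsg hg.mollify), ← integral_norm_sq_eq hu, ← integral_const_mul,
    ← Real.norm_eq_abs]
  refine norm_integral_le_of_norm_le ((hu.integrable_norm_pow (by simp)).const_mul _)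
    (Eventually.of_forall fun x => ?_)
  rw [← inner_sub_right, ← _root_.sub_apply, hd]
  have h1 := hη.norm_fderiv_mollify_le (hf.comp₂ hg (· - ·)) (hfi.sub hgi) hε hK x
  have h2 := mul_le_mul_of_nonneg_left (integral_norm_le_l2norm (hf2.sub hg2)) hK0
  have h3 := (fderiv ℝ (mollify η (fun x => f x - g x)) x).le_of_opNorm_le (h1.trans h2) (u x)
  refine (norm_inner_le_norm _ _).trans ?_
  calc ‖u x‖ * _ ≤ ‖u x‖ * _ := mul_le_mul_of_nonneg_left h3 (norm_nonneg _)
    _ = _ := by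
      simp only [Pi.sub_def]
      ring

/-- The flux of a divergence-free field through its mollification is controlled by the cubes of
its increments. -/
lemma enorm_flux_mollify_le {v : E3 → E3}
    (hv : IsPeriodic v) (h3 : MemLp v 3 torusMeasure) (hdiv : IsWeaklyDivFree v) {B : ℝ≥0∞}
    (hB : ∀ y, ‖y‖ ≤ ε → ∫⁻ x, ‖v (x - y) - v x‖ₑ ^ 3 ∂torusMeasure ≤ B) :
    ‖flux v (mollify η v)‖ₑ ≤ (∫⁻ y, ‖fderiv ℝ η y‖ₑ) * B := by
  rw [hη.flux_mollify_eq hv h3 hdiv, enorm_mul]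
  calc _ ≤ 1 * ‖∫ y, fderiv ℝ η y
          (∫ x, ‖v (x - y) - v x‖ ^ 2 • (v (x - y) - v x) ∂torusMeasure)‖ₑ := by
        gcongr
        rw [Real.enorm_eq_ofReal (by norm_num), ENNReal.ofReal_le_one]
        norm_num
    _ ≤ ∫⁻ y, ‖fderiv ℝ η y
          (∫ x, ‖v (x - y) - v x‖ ^ 2 • (v (x - y) - v x) ∂torusMeasure)‖ₑ := by
        rw [one_mul]
        exact enorm_integral_le_lintegral_enorm _
    _ ≤ ∫⁻ y, ‖fderiv ℝ η y‖ₑ * B := by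
        refine lintegral_mono fun y => ?_
        rcases le_or_gt ‖y‖ ε with h | h
        · refine (ContinuousLinearMap.le_opENorm _ _).trans ?_
          gcongr
          refine (enorm_integral_le_lintegral_enorm _).trans (le_trans (le_of_eq ?_) (hB y h))
          congr 1 with x
          rw [enorm_smul, enorm_pow, enorm_norm, ← pow_succ]
        · simp [hη.fderiv_eq_zero h]
    _ = _ := lintegral_mul_const _ hη.continuous_fderiv.enorm.measurable

variable {T : ℝ} {v : ℝ → E3 → E3} (hcont : ContinuousInL2 T v)
  (hT : 0 < T) (hE : IsWeakEulerSolution T v)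
include hcont hT hE

/-- Test the increment `v(t) - v(s)` with the mollifications of both `v(t)` and `v(s)` and add. The
two cross terms cancel by symmetry of the convolution, so no time derivative of `v` is needed. -/
lemma energy_sub_eq {s t : ℝ} (hs : s ∈ Icc 0 T) (ht : t ∈ Icc 0 T) :
    ∫ x, (inner ℝ (v t x) (mollify η (v t) x) : ℝ) ∂torusMeasure -
      ∫ x, (inner ℝ (v s x) (mollify η (v s) x) : ℝ) ∂torusMeasure =
    (∫ τ in s..t, flux (v τ) (mollify η (v t))) + ∫ τ in s..t, flux (v τ) (mollify η (v s)) := by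
  have hi : ∀ t ∈ Icc 0 T, Integrable (v t) torusMeasure := fun t ht =>
    (hcont.1 t ht).integrable (by norm_num)
  have hw : ∀ t' ∈ Icc 0 T, ∫ τ in s..t, flux (v τ) (mollify η (v t')) = _ := fun t' ht' =>
    (hE.integral_inner_sub hcont hT (hη.contDiff_mollify (hE.periodic t' ht') (hi t' ht'))
      (hE.periodic t' ht').mollify (hη.divergence_mollify_eq_zero (hE.periodic t' ht') (hi t' ht')
        (hE.isWeaklyDivFree hcont hT ht')) hs ht).symm
  rw [hw t ht, hw s hs, hη.integral_inner_mollify_comm (hE.periodic t ht) (hcont.1 t ht)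
    (hE.periodic s hs) (hcont.1 s hs)]
  ring

lemma enorm_energy_sub_le (hε : ε < 1 / 2) {t : ℝ} (ht : t ∈ Icc 0 T) :
    ‖∫ x, (inner ℝ (v t x) (mollify η (v t) x) : ℝ) ∂torusMeasure -
      ∫ x, (inner ℝ (v 0 x) (mollify η (v 0) x) : ℝ) ∂torusMeasure‖ₑ ≤
    2 * ∫⁻ τ in Ioo 0 T, ‖flux (v τ) (mollify η (v τ))‖ₑ := by
  obtain ⟨K, hK0, hK⟩ := hη.exists_fderiv_bound
  obtain ⟨M, hM0, hM⟩ := hcont.exists_bound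
  set F : ℝ → ℝ≥0∞ := fun τ => ‖flux (v τ) (mollify η (v τ))‖ₑ with hF
  -- Here `e` bounds the `L²` oscillation of `v` on short intervals; the error it causes disappears
  -- as `e → 0`.
  have key : ∀ e : ℝ, 0 < e → ‖∫ x, (inner ℝ (v t x) (mollify η (v t) x) : ℝ) ∂torusMeasure -
      ∫ x, (inner ℝ (v 0 x) (mollify η (v 0) x) : ℝ) ∂torusMeasure‖ₑ ≤
      (2 * ∫⁻ τ in Ioo 0 T, F τ) + 2 * (ENNReal.ofReal (K * e * M ^ 2) * ENNReal.ofReal T) := by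
    intro e he
    obtain ⟨δ, hδ, hu⟩ := hcont.uniform he
    have hstep : ∀ s ∈ Icc 0 T, ∀ t ∈ Icc 0 T, s ≤ t → t - s < δ → ∀ t' ∈ Icc s t,
        ‖∫ τ in s..t, flux (v τ) (mollify η (v t'))‖ₑ ≤
          ∫⁻ τ in Ioc s t, (F τ + ENNReal.ofReal (K * e * M ^ 2)) := by
      intro s hs t ht hst hδ' t' ht'
      rw [intervalIntegral.integral_of_le hst]
      refine (enorm_integral_le_lintegral_enorm _).trans
        (setLIntegral_mono' measurableSet_Ioc fun τ hτ => ?_)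
      have hτ' : τ ∈ Icc 0 T := ⟨hs.1.trans hτ.1.le, hτ.2.trans ht.2⟩
      have ht'' : t' ∈ Icc 0 T := ⟨hs.1.trans ht'.1, ht'.2.trans ht.2⟩
      have h1 := hη.abs_flux_sub_le hε hK (hcont.1 τ hτ') (hE.periodic t' ht'') (hcont.1 t' ht'')
        (hE.periodic τ hτ') (hcont.1 τ hτ')
      have h2 := hu τ hτ' t' ht'' (by
        rw [abs_lt]; constructor <;> linarith [hτ.1, hτ.2, ht'.1, ht'.2])
      have h3 : |flux (v τ) (mollify η (v t')) - flux (v τ) (mollify η (v τ))| ≤ K * e * M ^ 2 := by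
        refine h1.trans ?_
        have := hM τ hτ'
        have := l2norm_nonneg (v τ)
        gcongr
      calc ‖flux (v τ) (mollify η (v t'))‖ₑ = ‖flux (v τ) (mollify η (v τ)) +
            (flux (v τ) (mollify η (v t')) - flux (v τ) (mollify η (v τ)))‖ₑ := by congr 1; ring
        _ ≤ _ := by
          refine (enorm_add_le _ _).trans (add_le_add le_rfl ?_)
          rw [← ofReal_norm]
          exact ENNReal.ofReal_le_ofReal h3
    have h1 := enorm_sub_le_lintegral_of_local (T := T) hδ
      (E := fun t => ∫ x, (inner ℝ (v t x) (mollify η (v t) x) : ℝ) ∂torusMeasure)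
      (P := fun τ => 2 * (F τ + ENNReal.ofReal (K * e * M ^ 2))) (fun s hs t ht hst hδ' => by
        rw [hη.energy_sub_eq hcont hT hE hs ht, lintegral_const_mul' _ _ (by simp), two_mul]
        exact (enorm_add_le _ _).trans (add_le_add
          (hstep s hs t ht hst hδ' t ⟨hst, le_rfl⟩) (hstep s hs t ht hst hδ' s ⟨le_rfl, hst⟩))) ht
    refine h1.trans ?_
    rw [lintegral_const_mul' _ _ (by simp), ← mul_add]
    gcongr
    refine (lintegral_mono_set (Ioc_subset_Ioc_right ht.2)).trans (le_of_eq ?_)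
    rw [setLIntegral_congr Ioo_ae_eq_Ioc.symm, lintegral_add_right _ measurable_const]
    simp
  have hlim : Tendsto (fun e : ℝ => (2 * ∫⁻ τ in Ioo 0 T, F τ) +
      2 * (ENNReal.ofReal (K * e * M ^ 2) * ENNReal.ofReal T)) (𝓝[>] 0)
      (𝓝 ((2 * ∫⁻ τ in Ioo 0 T, F τ) + 2 * (ENNReal.ofReal (K * 0 * M ^ 2) * ENNReal.ofReal T))) := by
    refine Tendsto.mono_left (Continuous.tendsto ?_ 0) nhdsWithin_le_nhds
    refine continuous_const.add ?_
    refine ENNReal.continuous_const_mul (by simp) |>.comp ?_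
    exact (ENNReal.continuous_mul_const (by simp)).comp
      (ENNReal.continuous_ofReal.comp (by fun_prop))
  refine le_trans (ge_of_tendsto hlim ?_) (by simp)
  filter_upwards [self_mem_nhdsWithin] with e he using key e he

end IsMollifier

/-! ### A family of mollifiers -/

/-- Rescale one bump as `ε⁻³ φ(y / ε)`. The mass is preserved and the `L¹` norm of the gradient
gains exactly `ε⁻¹`, so `K` does not depend on `ε`. -/
lemma exists_isMollifier : ∃ K : ℝ, 0 ≤ K ∧ ∀ ε : ℝ, 0 < ε → ∃ η : E3 → ℝ, IsMollifier η ε ∧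
    ∫⁻ y, ‖fderiv ℝ η y‖ₑ ≤ ENNReal.ofReal (K / ε) := by
  let b : ContDiffBump (0 : E3) := ⟨1 / 2, 1, by norm_num, by norm_num⟩
  set φ : E3 → ℝ := b.normed volume with hφ
  have hφs : ContDiff ℝ ∞ φ := b.contDiff_normed
  have hφi : Integrable (fderiv ℝ φ) :=
    (hφs.continuous_fderiv (by simp)).integrable_of_hasCompactSupport
      (b.hasCompactSupport_normed.fderiv (𝕜 := ℝ))
  refine ⟨∫ y, ‖fderiv ℝ φ y‖, integral_nonneg fun _ => norm_nonneg _, fun ε hε => ?_⟩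
  have hfin : Module.finrank ℝ E3 = 3 := by simp
  have hfd : ∀ y, fderiv ℝ (fun y => (ε ^ 3)⁻¹ * φ (ε⁻¹ • y)) y =
      ((ε ^ 3)⁻¹ * ε⁻¹) • fderiv ℝ φ (ε⁻¹ • y) := by
    intro y
    have h1 : HasFDerivAt φ (fderiv ℝ φ (ε⁻¹ • y)) (ε⁻¹ • y) :=
      (hφs.differentiable (by simp) _).hasFDerivAt
    have h2 := (h1.comp y ((hasFDerivAt_id y).const_smul ε⁻¹)).const_mul (ε ^ 3)⁻¹
    refine h2.fderiv.trans ?_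
    ext u
    simp
    ring
  refine ⟨fun y => (ε ^ 3)⁻¹ * φ (ε⁻¹ • y), ⟨?_, ?_, ?_, ?_, ?_⟩, ?_⟩
  · exact contDiff_const.mul (hφs.comp (contDiff_const_smul _))
  · intro y
    rw [smul_neg, hφ, b.normed_neg]
  · intro y
    have := b.nonneg_normed (μ := volume) (ε⁻¹ • y)
    positivity
  · rw [integral_const_mul, Measure.integral_comp_smul, hφ, b.integral_normed, hfin, smul_eq_mul,
      mul_one, abs_of_pos (by positivity)]
    field_simp
  · intro y hy
    have : φ (ε⁻¹ • y) = 0 := by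
      rw [← Function.notMem_support, hφ, b.support_normed_eq, Metric.mem_ball, dist_zero_right,
        norm_smul, norm_inv, Real.norm_of_nonneg hε.le, not_lt]
      change 1 ≤ _
      rw [inv_mul_eq_div, le_div_iff₀ hε]
      linarith
    rw [this, mul_zero]
  · simp only [hfd]
    have hi : Integrable (fun y => ((ε ^ 3)⁻¹ * ε⁻¹) • fderiv ℝ φ (ε⁻¹ • y)) :=
      (hφi.comp_smul (inv_ne_zero hε.ne')).smul ((ε ^ 3)⁻¹ * ε⁻¹)
    rw [← ofReal_integral_norm_eq_lintegral_enorm hi]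
    refine ENNReal.ofReal_le_ofReal (le_of_eq ?_)
    simp only [norm_smul]
    rw [integral_const_mul, Measure.integral_comp_smul volume (fun y => ‖fderiv ℝ φ y‖), hfin,
      smul_eq_mul, abs_of_pos (by positivity), Real.norm_of_nonneg (by positivity)]
    field_simp

/-! ### Estimates off the singular set -/

lemma distTo_nonneg (S : Set E3) (x : E3) : 0 ≤ distTo S x := by
  rw [distTo]
  split_ifs
  · exact zero_le_one
  · exact Metric.infDist_nonneg

lemma continuous_distTo (S : Set E3) : Continuous (distTo S) := by
  unfold distTo
  split_ifs
  · exact continuous_const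
  · exact Metric.continuous_infDist_pt S

/-- The restriction `ρ < 1` serves the empty set, at distance `1` by convention: both sides are then
empty. -/
lemma setOf_distTo_le (S : Set E3) {ρ : ℝ} (hρ0 : 0 ≤ ρ) (hρ : ρ < 1) :
    {x | distTo S x ≤ ρ} = Metric.cthickening ρ S := by
  ext x
  rw [mem_ofPred_eq, Metric.mem_cthickening_iff, distTo]
  split_ifs with h
  · simp [h, hρ]
  · rw [Metric.infDist, ENNReal.le_ofReal_iff_toReal_le
      (Metric.infEDist_ne_top (nonempty_iff_ne_empty.2 h)) hρ0]

lemma half_distTo_le {S : Set E3} {x z : E3} (h : 2 * dist x z ≤ distTo S x) :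
    distTo S x / 2 ≤ distTo S z := by
  unfold distTo at *
  split_ifs at * with hS
  · norm_num
  · have := Metric.infDist_le_infDist_add_dist (s := S) (x := x) (y := z)
    linarith

lemma notMem_of_distTo_pos {S : Set E3} {x : E3} (h : 0 < distTo S x) : x ∉ S := by
  intro hx
  unfold distTo at h
  split_ifs at h with hS
  · simp [hS] at hx
  · rw [Metric.infDist_zero_of_mem hx] at h
    exact lt_irrefl _ h

/-- Away from the singular set the increments of `f` are Lipschitz, with a constant governed by
the distance to the singular set. -/
lemma IsC1OffWithBlowup.norm_sub_le {f : E3 → E3} {S : Set E3} {c κ : ℝ} (hS : IsClosed S)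
    (h : IsC1OffWithBlowup f S c κ) (hκ : 0 ≤ κ) {ε : ℝ} (hε : 0 < ε) {y : E3} (hy : ‖y‖ ≤ ε) :
    ∀ᵐ x, 2 * ε ≤ distTo S x →
      ‖f (x - y) - f x‖ ≤ |c| * 2 ^ κ * distTo S x ^ (-κ) * ε := by
  obtain ⟨u, huf, hu, hub⟩ := h
  rw [EventuallyEq, ae_restrict_iff' hS.isOpen_compl.measurableSet] at huf
  have huf' := (measurePreserving_sub_right volume y).quasiMeasurePreserving.ae huf
  filter_upwards [huf, huf'] with x h1 h2 hx
  -- At distance at least `2ε`, moving by `ε` at most halves the distance. This keeps the ball off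
  -- `S` and produces the factor `2 ^ κ`.
  have hball : ∀ z ∈ Metric.closedBall x ε, distTo S x / 2 ≤ distTo S z := by
    intro z hz
    rw [Metric.mem_closedBall, dist_comm] at hz
    exact half_distTo_le (by linarith)
  have hpos : 0 < distTo S x := by linarith
  have hnot : ∀ z ∈ Metric.closedBall x ε, z ∉ S := fun z hz =>
    notMem_of_distTo_pos (by linarith [hball z hz])
  have hxm : x ∈ Metric.closedBall x ε := Metric.mem_closedBall_self hε.le
  have hym : x - y ∈ Metric.closedBall x ε := by simpa [dist_eq_norm] using hy
  rw [← h1 (hnot x hxm), ← h2 (hnot _ hym)]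
  have h3 := (convex_closedBall x ε).norm_image_sub_le_of_norm_fderiv_le (𝕜 := ℝ) (f := u)
    (C := |c| * 2 ^ κ * distTo S x ^ (-κ))
    (fun z hz => ((hu z (hnot z hz)).contDiffAt
      (hS.isOpen_compl.mem_nhds (hnot z hz))).differentiableAt (by simp)) (fun z hz => by
        refine (hub z (hnot z hz)).trans ?_
        have h4 : distTo S z ^ (-κ) ≤ (distTo S x / 2) ^ (-κ) :=
          Real.rpow_le_rpow_of_nonpos (by linarith) (hball z hz) (by linarith)
        rw [Real.div_rpow hpos.le (by norm_num), Real.rpow_neg (by norm_num : (0 : ℝ) ≤ 2),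
          div_inv_eq_mul] at h4
        calc c * distTo S z ^ (-κ) ≤ |c| * distTo S z ^ (-κ) := by
              gcongr
              · exact Real.rpow_nonneg (distTo_nonneg _ _) _
              · exact le_abs_self c
          _ ≤ |c| * (distTo S x ^ (-κ) * 2 ^ κ) := by gcongr
          _ = _ := by ring) hxm hym
  refine h3.trans ?_
  rw [sub_sub_cancel_left, norm_neg]
  have := Real.rpow_nonneg hpos.le (-κ)
  gcongr

/-! ### Integrating negative powers of the distance -/

/-- Decompose into dyadic shells: where the distance lies between `ρ 2^{-k-1}` and `ρ 2^{-k}`, the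
integrand is at most its value at the inner radius. The bound depends on `S` only through `m`, hence
will be uniform in time. -/
lemma lintegral_distTo_rpow_le {S : Set E3} {ρ m q : ℝ} (hρ0 : 0 < ρ) (hq : 0 ≤ q)
    (h : ∀ k : ℕ, torusMeasure {x | distTo S x ≤ ρ * (1 / 2) ^ k} ≤
      ENNReal.ofReal ((2 * (ρ * (1 / 2) ^ k)) ^ m)) :
    ∫⁻ x in {x | 0 < distTo S x}, ENNReal.ofReal (distTo S x ^ (-q)) ∂torusMeasure ≤
      ENNReal.ofReal (ρ ^ (-q)) + ∑' k : ℕ, ENNReal.ofReal ((ρ * (1 / 2) ^ (k + 1)) ^ (-q)) *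
        ENNReal.ofReal ((2 * (ρ * (1 / 2) ^ k)) ^ m) := by
  have hmeas : ∀ k : ℕ, MeasurableSet {x | distTo S x ≤ ρ * (1 / 2) ^ k} := fun k =>
    (isClosed_le (continuous_distTo S) continuous_const).measurableSet
  calc ∫⁻ x in {x | 0 < distTo S x}, ENNReal.ofReal (distTo S x ^ (-q)) ∂torusMeasure
      ≤ ∫⁻ x in {x | 0 < distTo S x}, (ENNReal.ofReal (ρ ^ (-q)) +
        ∑' k : ℕ, {x | distTo S x ≤ ρ * (1 / 2) ^ k}.indicator
          (fun _ => ENNReal.ofReal ((ρ * (1 / 2) ^ (k + 1)) ^ (-q))) x) ∂torusMeasure := by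
        refine setLIntegral_mono' (isOpen_lt continuous_const
          (continuous_distTo S)).measurableSet fun x hx => ?_
        rw [mem_ofPred_eq] at hx
        rcases le_or_gt ρ (distTo S x) with h1 | h1
        · refine le_add_right (ENNReal.ofReal_le_ofReal ?_)
          exact Real.rpow_le_rpow_of_nonpos hρ0 h1 (by linarith)
        · obtain ⟨n, hn1, hn2⟩ := exists_nat_pow_near_of_lt_one (x := distTo S x / ρ)
            (y := (1 / 2 : ℝ)) (by positivity) ((div_le_one hρ0).2 h1.le) (by norm_num)
            (by norm_num)
          rw [lt_div_iff₀' hρ0] at hn1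
          rw [div_le_iff₀' hρ0] at hn2
          refine le_add_left (le_trans ?_ (ENNReal.le_tsum n))
          rw [indicator_of_mem (by exact hn2)]
          refine ENNReal.ofReal_le_ofReal ?_
          exact Real.rpow_le_rpow_of_nonpos (by positivity) hn1.le (by linarith)
    _ ≤ ∫⁻ x, (ENNReal.ofReal (ρ ^ (-q)) +
        ∑' k : ℕ, {x | distTo S x ≤ ρ * (1 / 2) ^ k}.indicator
          (fun _ => ENNReal.ofReal ((ρ * (1 / 2) ^ (k + 1)) ^ (-q))) x) ∂torusMeasure :=
        setLIntegral_le_lintegral _ _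
    _ = ENNReal.ofReal (ρ ^ (-q)) + ∑' k : ℕ, ENNReal.ofReal ((ρ * (1 / 2) ^ (k + 1)) ^ (-q)) *
        torusMeasure {x | distTo S x ≤ ρ * (1 / 2) ^ k} := by
        rw [lintegral_add_left measurable_const, lintegral_const, measure_univ, mul_one,
          lintegral_tsum fun k => (measurable_const.indicator (hmeas k)).aemeasurable]
        congr 2 with k
        rw [lintegral_indicator_const (hmeas k)]
    _ ≤ _ := by
        gcongr with k
        exact h k

/-- The series is geometric with ratio `2^{-(m - q)}`. -/
lemma tsum_dyadic_lt_top {ρ m q : ℝ} (hρ0 : 0 < ρ) (hqm : q < m) :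
    ENNReal.ofReal (ρ ^ (-q)) + ∑' k : ℕ, ENNReal.ofReal ((ρ * (1 / 2) ^ (k + 1)) ^ (-q)) *
        ENNReal.ofReal ((2 * (ρ * (1 / 2) ^ k)) ^ m) < ⊤ := by
  refine ENNReal.add_lt_top.2 ⟨by simp, ?_⟩
  have h1 : ∀ k : ℕ, ENNReal.ofReal ((ρ * (1 / 2) ^ (k + 1)) ^ (-q)) *
      ENNReal.ofReal ((2 * (ρ * (1 / 2) ^ k)) ^ m) =
      ENNReal.ofReal ((ρ * (1 / 2)) ^ (-q) * (2 * ρ) ^ m) *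
        ENNReal.ofReal ((1 / 2 : ℝ) ^ (m - q)) ^ k := by
    intro k
    rw [← ENNReal.ofReal_mul (by positivity), ← ENNReal.ofReal_pow (by positivity),
      ← ENNReal.ofReal_mul (by positivity)]
    congr 1
    have e1 : ρ * (1 / 2) ^ (k + 1) = (ρ * (1 / 2)) * (1 / 2) ^ k := by ring
    have e2 : 2 * (ρ * (1 / 2) ^ k) = (2 * ρ) * (1 / 2) ^ k := by ring
    rw [e1, e2, Real.mul_rpow (x := ρ * (1 / 2)) (by positivity) (by positivity),
      Real.mul_rpow (x := 2 * ρ) (by positivity) (by positivity), ← Real.rpow_natCast_mul (by norm_num),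
      ← Real.rpow_natCast_mul (by norm_num), ← Real.rpow_mul_natCast (by norm_num),
      show (m - q) * (k : ℝ) = k * m + k * (-q) by ring, Real.rpow_add (by norm_num)]
    ring
  simp only [h1]
  rw [ENNReal.tsum_mul_left, ENNReal.tsum_geometric]
  refine ENNReal.mul_lt_top (by simp) (ENNReal.inv_lt_top.2 (tsub_pos_of_lt ?_))
  rw [ENNReal.ofReal_lt_one]
  exact Real.rpow_lt_one (by norm_num) (by norm_num) (by linarith)

/-! ### Cubes of increments -/

lemma enorm_cube_lintegral_eq (f : E3 → E3) (μ : Measure E3) :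
    ∫⁻ x, ‖f x‖ₑ ^ 3 ∂μ = eLpNorm f 3 μ ^ 3 := by
  have := eLpNorm_nnreal_pow_eq_lintegral (f := f) (μ := μ) (p := 3) (by norm_num)
  simp only [NNReal.coe_ofNat, ENNReal.coe_ofNat] at this
  rw [← Nat.cast_ofNat (R := ℝ), ENNReal.rpow_natCast] at this
  rw [this]
  simp only [ENNReal.rpow_natCast]

lemma eLpNorm_sub_le_besovSeminorm {θ : ℝ} {p : ℝ≥0∞} (f : E3 → E3) (y : E3) :
    eLpNorm (fun x => f (x - y) - f x) p torusMeasure ≤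
      besovSeminorm θ p f * ENNReal.ofReal (‖y‖ ^ θ) := by
  rcases eq_or_ne y 0 with rfl | hy
  · simp
  · have h1 : 0 < ‖y‖ ^ θ := Real.rpow_pos_of_pos (norm_pos_iff.2 hy) _
    rw [← ENNReal.div_le_iff (by simpa using h1) (by simp)]
    have h2 : eLpNorm (fun x => f (-y + x) - f x) p torusMeasure / ENNReal.ofReal (‖-y‖ ^ θ) ≤
        besovSeminorm θ p f :=
      le_iSup₂ (f := fun (h : E3) (_ : h ≠ 0) =>
        eLpNorm (fun x => f (h + x) - f x) p torusMeasure / ENNReal.ofReal (‖h‖ ^ θ)) (-y)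
        (neg_ne_zero.2 hy)
    simpa only [norm_neg, neg_add_eq_sub] using h2

/-- Near a set of small measure, cubes of increments are controlled by the Besov seminorm. -/
lemma setLIntegral_cube_sub_le {θ : ℝ} (hθ : 0 ≤ θ) {r : ℝ≥0∞} (hr : 1 ≤ r) {f : E3 → E3}
    (hf : IsPeriodic f) (hfm : AEStronglyMeasurable f torusMeasure) {ε : ℝ} {y : E3}
    (hy : ‖y‖ ≤ ε) (A : Set E3) :
    ∫⁻ x in A, ‖f (x - y) - f x‖ₑ ^ 3 ∂torusMeasure ≤
      besovSeminorm θ (3 * r) f ^ 3 * ENNReal.ofReal (ε ^ (3 * θ)) *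
        torusMeasure A ^ conjRatio r := by
  have hε : 0 ≤ ε := (norm_nonneg y).trans hy
  have hm : AEStronglyMeasurable (fun x => f (x - y) - f x) (torusMeasure.restrict A) :=
    ((hf.aestronglyMeasurable_comp_sub hfm y).sub hfm).restrict
  have h1 := eLpNorm_le_eLpNorm_mul_rpow_measure_univ (p := 3) (q := 3 * r)
    (le_mul_of_one_le_right' hr) hm
  rw [Measure.restrict_apply_univ] at h1
  have h2 : eLpNorm (fun x => f (x - y) - f x) (3 * r) (torusMeasure.restrict A) ≤
      besovSeminorm θ (3 * r) f * ENNReal.ofReal (ε ^ θ) := by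
    refine (eLpNorm_mono_measure _ Measure.restrict_le_self).trans
      ((eLpNorm_sub_le_besovSeminorm (θ := θ) f y).trans ?_)
    gcongr
  -- The Hölder exponent from `L^{3r}` to `L³`, after cubing.
  have h3 : (1 / (3 : ℝ≥0∞).toReal - 1 / (3 * r).toReal) * 3 = conjRatio r := by
    rw [conjRatio, ENNReal.toReal_mul, ENNReal.toReal_inv]
    simp only [ENNReal.toReal_ofNat, one_div, mul_inv]
    ring
  rw [enorm_cube_lintegral_eq]
  calc eLpNorm (fun x => f (x - y) - f x) 3 (torusMeasure.restrict A) ^ 3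
      ≤ (besovSeminorm θ (3 * r) f * ENNReal.ofReal (ε ^ θ) *
        torusMeasure A ^ (1 / (3 : ℝ≥0∞).toReal - 1 / (3 * r).toReal)) ^ 3 := by
        gcongr
        exact h1.trans (by gcongr)
    _ = _ := by
        rw [mul_pow, mul_pow, ← ENNReal.ofReal_pow (by positivity), ← ENNReal.rpow_mul_natCast,
          Nat.cast_ofNat, h3, ← Real.rpow_mul_natCast hε, Nat.cast_ofNat, mul_comm θ]

/-- Away from the singular set, cubes of increments are controlled by negative powers of the
distance. -/
lemma setLIntegral_cube_sub_le_of_distTo {f : E3 → E3} {S : Set E3} {c κ : ℝ} (hS : IsClosed S)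
    (h : IsC1OffWithBlowup f S c κ) (hκ : 0 ≤ κ) {ε ρ q : ℝ} (hε : 0 < ε) (hερ : 2 * ε ≤ ρ)
    (hq : q ≤ 3 * κ) {y : E3} (hy : ‖y‖ ≤ ε) :
    ∫⁻ x in {x | ρ < distTo S x}, ‖f (x - y) - f x‖ₑ ^ 3 ∂torusMeasure ≤
      ENNReal.ofReal (2 ^ (3 * κ) * ε ^ 3 * ρ ^ (-(3 * κ - q))) * ‖c‖ₑ ^ 3 *
      ∫⁻ x in {x | 0 < distTo S x}, ENNReal.ofReal (distTo S x ^ (-q)) ∂torusMeasure := by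
  have hρ : 0 < ρ := by linarith
  have hms : MeasurableSet {x | ρ < distTo S x} :=
    (isOpen_lt continuous_const (continuous_distTo S)).measurableSet
  rw [← lintegral_const_mul' _ _ (ENNReal.mul_ne_top (by simp) (by simp))]
  refine le_trans ?_ (lintegral_mono_set (s := {x | ρ < distTo S x}) fun x hx => hρ.trans hx)
  refine setLIntegral_mono_ae' hms ?_
  have h1 := (torusMeasure_le_volume.absolutelyContinuous).ae_le (h.norm_sub_le hS hκ hε hy)
  filter_upwards [h1] with x h1 hx
  have hd : 0 < distTo S x := hρ.trans hx
  have h2 := h1 (by linarith)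
  have h3 : ‖f (x - y) - f x‖ ^ 3 ≤
      (2 ^ (3 * κ) * ε ^ 3 * ρ ^ (-(3 * κ - q))) * |c| ^ 3 * distTo S x ^ (-q) := by
    -- Split `dist^{-3κ}` into `dist^{-(3κ-q)}`, bounded by its value at `ρ`, and `dist^{-q}`, kept
    -- for integration.
    calc ‖f (x - y) - f x‖ ^ 3 ≤ (|c| * 2 ^ κ * distTo S x ^ (-κ) * ε) ^ 3 := by gcongr
      _ = (2 ^ (3 * κ) * ε ^ 3 * distTo S x ^ (-(3 * κ - q))) * |c| ^ 3 * distTo S x ^ (-q) := by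
        rw [mul_pow, mul_pow, mul_pow, ← Real.rpow_mul_natCast hd.le,
          ← Real.rpow_mul_natCast (by norm_num), Nat.cast_ofNat, mul_comm κ,
          show -κ * 3 = -(3 * κ - q) + -q by ring, Real.rpow_add hd]
        ring
      _ ≤ _ := by
        have := Real.rpow_nonneg hd.le (-q)
        gcongr ?_ * _ * _
        refine mul_le_mul_of_nonneg_left ?_ (by positivity)
        exact Real.rpow_le_rpow_of_nonpos hρ hx.le (by linarith)
  rw [← ofReal_norm, ← ofReal_norm, ← ENNReal.ofReal_pow (norm_nonneg _),
    ← ENNReal.ofReal_pow (norm_nonneg _), ← ENNReal.ofReal_mul (by positivity),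
    ← ENNReal.ofReal_mul (by positivity)]
  exact ENNReal.ofReal_le_ofReal h3

/-! ### The flux through small scales -/

lemma lintegral_cube_sub_le {θ : ℝ} (hθ : 0 ≤ θ) {r : ℝ≥0∞} (hr : 1 ≤ r) {f : E3 → E3}
    (hf : IsPeriodic f) (hfm : AEStronglyMeasurable f torusMeasure) {S : Set E3} {c κ : ℝ}
    (hS : IsClosed S) (h : IsC1OffWithBlowup f S c κ) (hκ : 0 ≤ κ) {ε ρ q : ℝ} (hε : 0 < ε)
    (hερ : 2 * ε ≤ ρ) (hq : q ≤ 3 * κ) {y : E3} (hy : ‖y‖ ≤ ε) :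
    ∫⁻ x, ‖f (x - y) - f x‖ₑ ^ 3 ∂torusMeasure ≤
      besovSeminorm θ (3 * r) f ^ 3 * ENNReal.ofReal (ε ^ (3 * θ)) *
        torusMeasure {x | distTo S x ≤ ρ} ^ conjRatio r +
      ENNReal.ofReal (2 ^ (3 * κ) * ε ^ 3 * ρ ^ (-(3 * κ - q))) * ‖c‖ₑ ^ 3 *
        ∫⁻ x in {x | 0 < distTo S x}, ENNReal.ofReal (distTo S x ^ (-q)) ∂torusMeasure := by
  have hm : MeasurableSet {x | distTo S x ≤ ρ} :=
    (isClosed_le (continuous_distTo S) continuous_const).measurableSet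
  rw [← lintegral_add_compl _ hm]
  refine add_le_add (setLIntegral_cube_sub_le hθ hr hf hfm hy _) ?_
  have hc : {x | distTo S x ≤ ρ}ᶜ = {x | ρ < distTo S x} := by
    ext x
    simp
  rw [hc]
  exact setLIntegral_cube_sub_le_of_distTo hS h hκ hε hερ hq hy

lemma conjRatio_mem {r : ℝ≥0∞} (hr : 1 < r) : conjRatio r ∈ Ioc (0 : ℝ) 1 := by
  have h1 : r⁻¹ < 1 := ENNReal.inv_lt_one.2 hr
  have h2 : (r⁻¹).toReal < 1 := by
    simpa using (ENNReal.toReal_lt_toReal h1.ne_top ENNReal.one_ne_top).2 h1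
  exact ⟨by rw [conjRatio]; linarith, by rw [conjRatio]; linarith [ENNReal.toReal_nonneg (a := r⁻¹)]⟩

/-- The scale `ε ^ α` separating the neighbourhood of the singular set from its complement, and the
power `q` of the distance that is integrable. -/
lemma exists_exponents {θ κ s c : ℝ} (hθ₁ : θ < 1 / 3) (hc : c ∈ Ioc (0 : ℝ) 1)
    (hκ : 0 ≤ κ) (h : s < if κ ≤ 1 - θ then 3 - c⁻¹ * (1 - 3 * θ)
      else 3 - κ / (1 - θ) * c⁻¹ * (1 - 3 * θ)) :
    ∃ α q : ℝ, 0 < α ∧ α < 1 ∧ 0 ≤ q ∧ q < 3 - s ∧ q ≤ 3 * κ ∧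
      0 < 3 * θ - 1 + α * ((3 - s) * c) ∧ 0 < 2 - α * (3 * κ - q) := by
  obtain ⟨hc0, hc1⟩ := hc
  have hθ' : 0 < 1 - 3 * θ := by linarith
  -- The quotient is the threshold `β` that `α` must exceed for the near part. If `κ ≤ 1 - θ` the
  -- binding condition is `β < 1`; otherwise it is `κβ < 1 - θ`, which implies `β < 1`.
  have key : 0 < (3 - s) * c ∧ (1 - 3 * θ) / ((3 - s) * c) < 1 ∧
      3 * κ * ((1 - 3 * θ) / ((3 - s) * c)) < 3 * (1 - θ) := by
    split_ifs at h with hk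
    · have h1 : 1 - 3 * θ < (3 - s) * c := by
        have : c⁻¹ * (1 - 3 * θ) < 3 - s := by linarith
        rw [inv_mul_lt_iff₀ hc0] at this
        linarith
      have h0 : 0 < (3 - s) * c := by linarith
      have h2 : (1 - 3 * θ) / ((3 - s) * c) < 1 := (div_lt_one h0).2 h1
      refine ⟨h0, h2, ?_⟩
      have h3 : 0 < (1 - 3 * θ) / ((3 - s) * c) := by positivity
      nlinarith
    · push Not at hk
      have hθ1 : 0 < 1 - θ := by linarith
      have hκ0 : 0 < κ := by linarith
      have h1 : κ / (1 - θ) * (1 - 3 * θ) < (3 - s) * c := by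
        have : c⁻¹ * (κ / (1 - θ) * (1 - 3 * θ)) < 3 - s := by linarith
        rwa [inv_mul_lt_iff₀ hc0, mul_comm c] at this
      have h0 : 0 < (3 - s) * c := lt_trans (by positivity) h1
      have h4 : κ * ((1 - 3 * θ) / ((3 - s) * c)) < 1 - θ := by
        rw [← mul_div_assoc, div_lt_iff₀ h0, ← div_lt_iff₀' hθ1]
        rwa [div_mul_eq_mul_div] at h1
      refine ⟨h0, ?_, by linarith⟩
      by_contra hcon
      push Not at hcon
      nlinarith
  obtain ⟨hm0, hβ1, hβ2⟩ := key
  set m := 3 - s with hm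
  have hmpos : 0 < m := pos_of_mul_pos_left hm0 hc0.le
  set β := (1 - 3 * θ) / (m * c) with hβ
  have hβ0 : 0 < β := by positivity
  have hβm : 1 - 3 * θ ≤ β * m := by
    have : β * m * c = 1 - 3 * θ := by rw [hβ]; field_simp
    nlinarith [mul_pos hβ0 hmpos]
  -- The last condition is the limiting case `q = m` of the far-part condition. It holds at `β`
  -- since `3κβ < 3(1 - θ)` and `βm ≥ 1 - 3θ`.
  obtain ⟨α, hα0, hα1, hα2⟩ : ∃ α, β < α ∧ α < 1 ∧ α * (3 * κ - m) < 2 := by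
    rcases le_or_gt (3 * κ - m) 0 with h1 | h1
    · obtain ⟨α, h2, h3⟩ := exists_between hβ1
      exact ⟨α, h2, h3, by nlinarith⟩
    · have h4 : β < 2 / (3 * κ - m) := by
        rw [lt_div_iff₀ h1]
        linarith
      obtain ⟨α, h2, h3⟩ := exists_between (lt_min hβ1 h4)
      rw [lt_min_iff] at h3
      exact ⟨α, h2, h3.1, (lt_div_iff₀ h1).1 h3.2⟩
  have hαpos : 0 < α := hβ0.trans hα0
  have hflux : 0 < 3 * θ - 1 + α * (m * c) := by
    have := (div_lt_iff₀ hm0).1 hα0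
    linarith
  -- If `dist^{-3κ}` is itself integrable, take `q = 3κ` and nothing is lost. Otherwise `q` lies
  -- strictly below `m`, close enough to keep the strict inequality.
  rcases lt_or_ge (3 * κ) m with h1 | h1
  · exact ⟨α, 3 * κ, hαpos, hα1, by linarith, h1, le_rfl, hflux, by simp⟩
  · have h2 : max 0 (3 * κ - 2 / α) < m := by
      refine max_lt hmpos ?_
      have : (3 * κ - m) < 2 / α := by
        rw [lt_div_iff₀' hαpos]
        exact hα2
      linarith
    obtain ⟨q, h3, h4⟩ := exists_between h2
    rw [max_lt_iff] at h3
    refine ⟨α, q, hαpos, hα1, h3.1.le, h4, by linarith, hflux, ?_⟩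
    have : 3 * κ - q < 2 / α := by linarith
    rw [lt_div_iff₀' hαpos] at this
    linarith

/-- Shows that the infimum defining the dimension runs over a nonempty set. Any exponent above `3`
would do, as the torus has finite measure. -/
lemma minkowskiContent_four (T : ℝ) (S : ℝ → Set E3) : minkowskiContent T S 4 = 0 := by
  refine Tendsto.limsup_eq ?_
  have hlim : Tendsto (fun ε : ℝ => ENNReal.ofReal (2 * ε)) (𝓝[>] 0) (𝓝 0) := by
    have : Continuous fun ε : ℝ => ENNReal.ofReal (2 * ε) :=
      ENNReal.continuous_ofReal.comp (by fun_prop)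
    simpa using (this.tendsto 0).mono_left nhdsWithin_le_nhds
  refine tendsto_of_tendsto_of_tendsto_of_le_of_le tendsto_const_nhds hlim (fun _ => zero_le)
    fun ε => ?_
  refine essSup_le_of_ae_le _ (Eventually.of_forall fun t => ?_)
  norm_num
  exact mul_le_of_le_one_right' prob_le_one

/-- A bound on the Minkowski dimension bounds the measure of neighbourhoods uniformly in time. -/
lemma exists_measure_le_of_minkowskiDim_lt {T γ : ℝ} {S : ℝ → Set E3} (h : minkowskiDim T S < γ) :
    ∃ s < γ, ∃ ρ₀ : ℝ, 0 < ρ₀ ∧ ρ₀ < 1 ∧ ∀ ρ : ℝ, 0 < ρ → ρ ≤ ρ₀ →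
      ∀ᵐ t ∂(volume.restrict (Icc 0 T)),
        torusMeasure {x | distTo (S t) x ≤ ρ} ≤ ENNReal.ofReal ((2 * ρ) ^ (3 - s)) := by
  obtain ⟨s, ⟨-, hs⟩, hsγ⟩ := exists_lt_of_csInf_lt
    (show {s : ℝ | 0 ≤ s ∧ minkowskiContent T S s = 0}.Nonempty from
      ⟨4, by norm_num, minkowskiContent_four T S⟩) h
  -- Since the content is zero, it is eventually below `1`, so the measure bound carries no
  -- constant.
  have h1 := eventually_lt_of_limsup_lt (hs.trans_lt zero_lt_one)
  rw [eventually_nhdsWithin_iff, Metric.eventually_nhds_iff] at h1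
  obtain ⟨ρ₁, hρ₁, h2⟩ := h1
  refine ⟨s, hsγ, min ρ₁ 1 / 2, by positivity, by linarith [min_le_right ρ₁ 1], fun ρ hρ hρ' => ?_⟩
  have hlt1 : ρ < ρ₁ := by
    have : 0 < min ρ₁ 1 := lt_min hρ₁ one_pos
    linarith [min_le_left ρ₁ 1]
  have h3 := h2 (y := ρ) (by simpa [abs_of_pos hρ] using hlt1) hρ
  filter_upwards [ae_le_essSup (μ := volume.restrict (Icc 0 T)) (f := fun t =>
    ENNReal.ofReal ((2 * ρ) ^ (s - 3)) * torusMeasure (Metric.cthickening ρ (S t)))] with t ht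
  rw [setOf_distTo_le _ hρ.le (by linarith [min_le_right ρ₁ 1])]
  have h4 := ht.trans h3.le
  have h5 : 0 < (2 * ρ) ^ (s - 3) := by positivity
  rw [← neg_sub s 3, Real.rpow_neg (by positivity), ENNReal.ofReal_inv_of_pos h5]
  exact ENNReal.le_inv_iff_le_inv.1 (ENNReal.le_inv_iff_mul_le.2 h4)

/-! ### Vanishing of the flux and conservation of energy -/

lemma MemBesov.memLp_three {θ : ℝ} {r : ℝ≥0∞} (hr : 1 ≤ r) {f : E3 → E3}
    (h : MemBesov θ (3 * r) f) : MemLp f 3 torusMeasure :=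
  h.1.mono_exponent (le_mul_of_one_le_right' hr)

/-- The energy of the mollification converges to the energy for Besov fields. -/
lemma abs_energy_mollify_sub_le {θ : ℝ} (hθ : 0 ≤ θ) {r : ℝ≥0∞} (hr : 1 ≤ r) {f : E3 → E3}
    (hf : IsPeriodic f) (hf2 : MemLp f 2 torusMeasure) (h : MemBesov θ (3 * r) f) {η : E3 → ℝ}
    {ε : ℝ} (hη : IsMollifier η ε) :
    |∫ x, (inner ℝ (f x) (mollify η f x) : ℝ) ∂torusMeasure - l2norm f ^ 2| ≤
      l2norm f * ((besovSeminorm θ (3 * r) f).toReal * ε ^ θ) := by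
  have hε : 0 ≤ ε := by
    by_contra hneg
    push Not at hneg
    have : η = 0 := funext fun y => hη.support y (hneg.trans_le (norm_nonneg y))
    simpa [this] using hη.integral_eq_one
  have h1 : ∀ y, ‖y‖ ≤ ε → l2norm (fun x => f (x - y) - f x) ≤
      (besovSeminorm θ (3 * r) f).toReal * ε ^ θ := by
    intro y hy
    have hm := (hf.aestronglyMeasurable_comp_sub hf2.1 y).sub hf2.1
    have h2 : eLpNorm (fun x => f (x - y) - f x) 2 torusMeasure ≤
        besovSeminorm θ (3 * r) f * ENNReal.ofReal (ε ^ θ) := by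
      refine (eLpNorm_le_eLpNorm_of_exponent_le (q := 3 * r) ?_ hm).trans
        ((eLpNorm_sub_le_besovSeminorm (θ := θ) f y).trans ?_)
      · exact le_trans (by norm_num) (le_mul_of_one_le_right' hr)
      · gcongr
    have h3 := ENNReal.toReal_mono (ENNReal.mul_ne_top h.2.ne (by simp)) h2
    rwa [ENNReal.toReal_mul, ENNReal.toReal_ofReal (by positivity)] at h3
  rw [hη.integral_inner_mollify hf2 hf hf2]
  have h4 : ∀ y, ∫ x, (inner ℝ (f x) (f (x - y)) : ℝ) ∂torusMeasure = l2norm f ^ 2 +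
      ∫ x, (inner ℝ (f x) (f (x - y) - f x) : ℝ) ∂torusMeasure := by
    intro y
    have hy2 := hf.memLp_comp_sub (by norm_num) (by norm_num) hf2 y
    simp only [inner_sub_right]
    rw [integral_sub (integrable_inner hf2 hy2) (integrable_inner hf2 hf2),
      ← integral_norm_sq_eq hf2]
    simp
  -- As the kernel has mass one, the energy defect is an average of pairings of `f` with its
  -- increments.
  have h5 : (∫ y, η y * ∫ x, (inner ℝ (f x) (f (x - y)) : ℝ) ∂torusMeasure) - l2norm f ^ 2 =
      ∫ y, η y * ∫ x, (inner ℝ (f x) (f (x - y) - f x) : ℝ) ∂torusMeasure := by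
    have h6 : ∫ y, η y * l2norm f ^ 2 = l2norm f ^ 2 := by
      rw [integral_mul_const, hη.integral_eq_one, one_mul]
    conv_lhs => rw [← h6]
    rw [← integral_sub (hη.integrable_mul_integral_inner hf2 hf hf2) (hη.integrable.mul_const _)]
    congr 1 with y
    rw [h4]
    ring
  rw [h5, ← Real.norm_eq_abs]
  calc _ ≤ ∫ y, η y * (l2norm f * ((besovSeminorm θ (3 * r) f).toReal * ε ^ θ)) := by
        refine norm_integral_le_of_norm_le (hη.integrable.mul_const _) (Eventually.of_forall fun y => ?_)
        rw [norm_mul, Real.norm_of_nonneg (hη.nonneg y)]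
        rcases le_or_gt ‖y‖ ε with hy | hy
        · refine mul_le_mul_of_nonneg_left ?_ (hη.nonneg y)
          have hy2 := hf.memLp_comp_sub (by norm_num) (by norm_num) hf2 y
          exact (abs_integral_inner_le hf2 (hy2.sub hf2)).trans
            (mul_le_mul_of_nonneg_left (h1 y hy) (l2norm_nonneg f))
        · simp [hη.support y hy]
    _ = _ := by rw [integral_mul_const, hη.integral_eq_one, one_mul]

/-- Collecting powers of `ε`, including the `ε⁻¹` from the kernel, leaves exactly the two exponents
assumed positive. -/
lemma tendsto_flux_bound {θ κ α q m c K : ℝ} (hK : 0 ≤ K) (hc : 0 ≤ c)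
    (h1 : 0 < 3 * θ - 1 + α * (m * c))
    (h2 : 0 < 2 - α * (3 * κ - q)) {G C M : ℝ≥0∞} (hG : G ≠ ⊤) (hC : C ≠ ⊤) (hM : M ≠ ⊤) :
    Tendsto (fun ε : ℝ => ENNReal.ofReal (K / ε) *
      (ENNReal.ofReal (ε ^ (3 * θ)) * ENNReal.ofReal ((2 * ε ^ α) ^ m) ^ c * G +
        ENNReal.ofReal (2 ^ (3 * κ) * ε ^ 3 * (ε ^ α) ^ (-(3 * κ - q))) * M * C)) (𝓝[>] 0) (𝓝 0) := by
  have hpow : ∀ {e A : ℝ} {B : ℝ≥0∞}, 0 < e → B ≠ ⊤ →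
      Tendsto (fun ε : ℝ => ENNReal.ofReal (A * ε ^ e) * B) (𝓝[>] 0) (𝓝 0) := by
    intro e A B he hB
    have l1 := (Real.continuousAt_rpow_const 0 e (Or.inr he.le)).tendsto
    rw [Real.zero_rpow he.ne'] at l1
    have l2 := ENNReal.tendsto_ofReal ((l1.const_mul A).mono_left (nhdsWithin_le_nhds (s := Ioi 0)))
    rw [mul_zero, ENNReal.ofReal_zero] at l2
    simpa using ENNReal.Tendsto.mul_const l2 (Or.inr hB)
  have hsum := (hpow (A := K * 2 ^ (m * c)) h1 hG).add
    (hpow (A := K * 2 ^ (3 * κ)) h2 (ENNReal.mul_ne_top hM hC))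
  rw [add_zero] at hsum
  refine hsum.congr' ?_
  filter_upwards [self_mem_nhdsWithin] with ε hε
  have hε' : (0 : ℝ) < ε := hε
  have r1 : K * 2 ^ (m * c) * ε ^ (3 * θ - 1 + α * (m * c)) =
      K / ε * (ε ^ (3 * θ) * ((2 * ε ^ α) ^ m) ^ c) := by
    rw [← Real.rpow_mul (by positivity), Real.mul_rpow (by norm_num) (by positivity),
      ← Real.rpow_mul hε'.le, Real.rpow_add hε', Real.rpow_sub hε', Real.rpow_one]
    ring
  have r2 : K * 2 ^ (3 * κ) * ε ^ (2 - α * (3 * κ - q)) =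
      K / ε * (2 ^ (3 * κ) * ε ^ 3 * (ε ^ α) ^ (-(3 * κ - q))) := by
    rw [← Real.rpow_mul hε'.le, Real.rpow_sub hε', ← neg_mul_eq_mul_neg, Real.rpow_neg hε'.le,
      show ε ^ (2 : ℝ) = ε ^ 2 by norm_cast]
    field_simp
  rw [r1, r2, ENNReal.ofReal_mul (by positivity), ENNReal.ofReal_mul (by positivity),
    ENNReal.ofReal_mul (p := K / ε) (by positivity),
    ENNReal.ofReal_rpow_of_nonneg (by positivity) hc]
  ring

end EulerTorus

open EulerTorus in
theorem theorem1p1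
    (T : ℝ) (hT : 0 < T)
    (θ : ℝ) (hθ₀ : 0 < θ) (hθ₁ : θ < 1 / 3)
    (r : ℝ≥0∞) (hr : ENNReal.ofReal (3 / (2 + 3 * θ)) < r)
    (v : ℝ → EulerTorus.E3 → EulerTorus.E3)
    (hBesov : EulerTorus.MemL3Besov T θ (3 * r) v)
    (hcont : EulerTorus.ContinuousInL2 T v)
    (hEuler : EulerTorus.IsWeakEulerSolution T v)
    (S : ℝ → Set EulerTorus.E3)
    (hS : ∀ᵐ t ∂(volume.restrict (Icc 0 T)),
      IsClosed (S t) ∧ EulerTorus.IsPeriodic (fun x => x ∈ S t))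
    (hdim : EulerTorus.minkowskiDim T S < 3)
    (κ : ℝ) (hκ₀ : 0 ≤ κ)
    (hκ₁ : κ < EulerTorus.conjRatio r * (3 * (1 - θ) / (1 - 3 * θ)))
    (C : ℝ → ℝ) (hC : MemLp C 3 (volume.restrict (Ioo 0 T)))
    (hv : ∀ᵐ t ∂(volume.restrict (Icc 0 T)), EulerTorus.IsC1OffWithBlowup (v t) (S t) (C t) κ)
    (hγ : EulerTorus.minkowskiDim T S <
      if κ ≤ 1 - θ then 3 - (EulerTorus.conjRatio r)⁻¹ * (1 - 3 * θ)
      else 3 - κ / (1 - θ) * (EulerTorus.conjRatio r)⁻¹ * (1 - 3 * θ)) :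
    ∀ t ∈ Icc 0 T, EulerTorus.kineticEnergy v t = EulerTorus.kineticEnergy v 0 := by
  -- From `3θ < 1` one gets `3 / (2 + 3θ) > 1`.
  have hr1 : 1 < r := by
    refine lt_of_le_of_lt ?_ hr
    rw [← ENNReal.ofReal_one]
    refine ENNReal.ofReal_le_ofReal ?_
    rw [le_div_iff₀ (by linarith)]
    linarith
  obtain ⟨s, hs, ρ₀, hρ₀, hρ₀1, hmeas⟩ := exists_measure_le_of_minkowskiDim_lt hγ
  obtain ⟨α, q, hα0, hα1, hq0, hqm, hqκ, he1, he2⟩ :=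
    exists_exponents hθ₁ (conjRatio_mem hr1) hκ₀ hs
  obtain ⟨K, hK0, hmoll⟩ := exists_isMollifier
  have htoIoo : ∀ {p : ℝ → Prop}, (∀ᵐ t ∂(volume.restrict (Icc 0 T)), p t) →
      ∀ᵐ t ∂(volume.restrict (Ioo 0 T)), p t := fun hp =>
    ae_restrict_of_ae_restrict_of_subset Ioo_subset_Icc_self hp
  set M : ℝ≥0∞ := ENNReal.ofReal (ρ₀ ^ (-q)) +
    ∑' k : ℕ, ENNReal.ofReal ((ρ₀ * (1 / 2) ^ (k + 1)) ^ (-q)) *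
      ENNReal.ofReal ((2 * (ρ₀ * (1 / 2) ^ k)) ^ (3 - s)) with hM
  have hMtop : M < ⊤ := tsum_dyadic_lt_top hρ₀ hqm
  have hdist : ∀ᵐ t ∂(volume.restrict (Ioo 0 T)),
      ∫⁻ x in {x | 0 < distTo (S t) x}, ENNReal.ofReal (distTo (S t) x ^ (-q)) ∂torusMeasure ≤ M := by
    -- The measure bound has a null set of bad times for each radius; using only dyadic radii keeps
    -- their union null.
    have : ∀ᵐ t ∂(volume.restrict (Ioo 0 T)), ∀ k : ℕ,
        torusMeasure {x | distTo (S t) x ≤ ρ₀ * (1 / 2) ^ k} ≤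
          ENNReal.ofReal ((2 * (ρ₀ * (1 / 2) ^ k)) ^ (3 - s)) :=
      ae_all_iff.2 fun k => htoIoo (hmeas _ (by positivity)
        (mul_le_of_le_one_right hρ₀.le (pow_le_one₀ (by norm_num) (by norm_num))))
    filter_upwards [this] with t ht using lintegral_distTo_rpow_le hρ₀ hq0 ht
  set G : ℝ≥0∞ := ∫⁻ t in Ioo 0 T, besovNorm θ (3 * r) (v t) ^ 3 with hG
  set C3 : ℝ≥0∞ := ∫⁻ t in Ioo 0 T, ‖C t‖ₑ ^ 3 with hC3
  have hC3top : C3 < ⊤ := by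
    simpa using (eLpNorm_lt_top_iff_lintegral_rpow_enorm_lt_top (by norm_num) (by norm_num)).1 hC.2
  have hfluxbound : ∀ᶠ ε : ℝ in 𝓝[>] 0, ∀ η : E3 → ℝ, IsMollifier η ε →
      ∫⁻ y, ‖fderiv ℝ η y‖ₑ ≤ ENNReal.ofReal (K / ε) →
      ∫⁻ t in Ioo 0 T, ‖flux (v t) (mollify η (v t))‖ₑ ≤ ENNReal.ofReal (K / ε) *
        (ENNReal.ofReal (ε ^ (3 * θ)) * ENNReal.ofReal ((2 * ε ^ α) ^ (3 - s)) ^ conjRatio r * G +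
          ENNReal.ofReal (2 ^ (3 * κ) * ε ^ 3 * (ε ^ α) ^ (-(3 * κ - q))) * M * C3) := by
    have ev1 : ∀ᶠ ε : ℝ in 𝓝[>] 0, ε ^ α ≤ ρ₀ := by
      have : Tendsto (fun ε : ℝ => ε ^ α) (𝓝[>] 0) (𝓝 0) := by
        have := (Real.continuousAt_rpow_const 0 α (Or.inr hα0.le)).tendsto
        rw [Real.zero_rpow hα0.ne'] at this
        exact this.mono_left nhdsWithin_le_nhds
      exact (this.eventually (gt_mem_nhds hρ₀)).mono fun _ => le_of_lt
    have ev2 : ∀ᶠ ε : ℝ in 𝓝[>] 0, 2 * ε ≤ ε ^ α := by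
      have : Tendsto (fun ε : ℝ => 2 * ε ^ (1 - α)) (𝓝[>] 0) (𝓝 0) := by
        have := (Real.continuousAt_rpow_const 0 (1 - α) (Or.inr (by linarith))).tendsto
        rw [Real.zero_rpow (by linarith)] at this
        simpa using (this.mono_left nhdsWithin_le_nhds).const_mul 2
      filter_upwards [this.eventually (gt_mem_nhds one_pos), self_mem_nhdsWithin] with ε h1 hε
      have hε' : (0 : ℝ) < ε := hε
      have h2 : ε = ε ^ (1 - α) * ε ^ α := by
        rw [← Real.rpow_add hε']
        simp
      have h3 : 0 ≤ ε ^ α := by positivity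
      calc 2 * ε = (2 * ε ^ (1 - α)) * ε ^ α := by rw [mul_assoc, ← h2]
        _ ≤ 1 * ε ^ α := by gcongr
        _ = _ := one_mul _
    filter_upwards [ev1, ev2, self_mem_nhdsWithin] with ε h1 h2 hε η hη hηK
    have hε' : (0 : ℝ) < ε := hε
    have hpt : ∀ᵐ t ∂(volume.restrict (Ioo 0 T)), ‖flux (v t) (mollify η (v t))‖ₑ ≤
        ENNReal.ofReal (K / ε) *
        (ENNReal.ofReal (ε ^ (3 * θ)) * ENNReal.ofReal ((2 * ε ^ α) ^ (3 - s)) ^ conjRatio r *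
          besovNorm θ (3 * r) (v t) ^ 3 +
        ENNReal.ofReal (2 ^ (3 * κ) * ε ^ 3 * (ε ^ α) ^ (-(3 * κ - q))) * M * ‖C t‖ₑ ^ 3) := by
      filter_upwards [htoIoo hS, htoIoo hv, htoIoo (hmeas (ε ^ α) (by positivity) h1), hdist,
        hBesov.1, ae_restrict_mem measurableSet_Ioo] with t tS tv tm td tB tmem
      have tIcc := Ioo_subset_Icc_self tmem
      refine (hη.enorm_flux_mollify_le (hEuler.periodic t tIcc) (tB.memLp_three hr1.le)
        (hEuler.isWeaklyDivFree hcont hT tIcc) fun y hy => ?_).trans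
        (mul_le_mul_left hηK _)
      refine (lintegral_cube_sub_le hθ₀.le hr1.le (hEuler.periodic t tIcc) (hcont.1 t tIcc).1 tS.1
        tv hκ₀ hε' h2 hqκ hy).trans ?_
      refine add_le_add ?_ ?_
      · have hb : besovSeminorm θ (3 * r) (v t) ≤ besovNorm θ (3 * r) (v t) := le_add_self
        have hc := (conjRatio_mem hr1).1.le
        calc _ ≤ besovNorm θ (3 * r) (v t) ^ 3 * ENNReal.ofReal (ε ^ (3 * θ)) *
              ENNReal.ofReal ((2 * ε ^ α) ^ (3 - s)) ^ conjRatio r := by gcongr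
          _ = _ := by ring
      · calc _ ≤ ENNReal.ofReal (2 ^ (3 * κ) * ε ^ 3 * (ε ^ α) ^ (-(3 * κ - q))) * ‖C t‖ₑ ^ 3 *
              M := by gcongr
          _ = _ := by ring
    refine (lintegral_mono_ae hpt).trans (le_of_eq ?_)
    have hfin : ENNReal.ofReal ((2 * ε ^ α) ^ (3 - s)) ^ conjRatio r ≠ ⊤ :=
      ENNReal.rpow_ne_top_of_nonneg (conjRatio_mem hr1).1.le (by simp)
    -- Additivity uses measurability of the summand with `C` alone, so measurability in time of the
    -- Besov norm is not required.
    rw [lintegral_const_mul' _ _ (by simp), lintegral_add_right',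
      lintegral_const_mul' _ _ (ENNReal.mul_ne_top (by simp) hfin),
      lintegral_const_mul' _ _ (ENNReal.mul_ne_top (by simp) hMtop.ne)]
    exact ((hC.1.enorm.pow_const 3).const_mul _)
  have hflux0 := (tendsto_flux_bound hK0 (conjRatio_mem hr1).1.le he1 he2 hBesov.2.ne hC3top.ne hMtop.ne)
  have hgood : ∀ t ∈ Icc 0 T, ∀ t' ∈ Icc 0 T, MemBesov θ (3 * r) (v t) → MemBesov θ (3 * r) (v t') →
      l2norm (v t) ^ 2 = l2norm (v t') ^ 2 := by
    intro t ht t' ht' hB hB'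
    have hpow : ∀ A B : ℝ, Tendsto (fun ε : ℝ => ENNReal.ofReal (A * (B * ε ^ θ))) (𝓝[>] 0) (𝓝 0) := by
      intro A B
      have l1 := (Real.continuousAt_rpow_const 0 θ (Or.inr hθ₀.le)).tendsto
      rw [Real.zero_rpow hθ₀.ne'] at l1
      have l2 := ENNReal.tendsto_ofReal (((l1.const_mul B).const_mul A).mono_left
        (nhdsWithin_le_nhds (s := Ioi 0)))
      simpa using l2
    have hlim := ((hpow (l2norm (v t)) (besovSeminorm θ (3 * r) (v t)).toReal).add
      (hpow (l2norm (v t')) (besovSeminorm θ (3 * r) (v t')).toReal)).add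
      -- The factor `4` comes from comparing both times with time `0`, at a cost of twice the flux
      -- each.
      (ENNReal.Tendsto.const_mul (a := 4) hflux0 (Or.inr (by simp)))
    simp only [add_zero, mul_zero] at hlim
    have hle : ‖l2norm (v t) ^ 2 - l2norm (v t') ^ 2‖ₑ ≤ 0 := by
      refine ge_of_tendsto hlim ?_
      filter_upwards [hfluxbound, Ioo_mem_nhdsGT (show (0 : ℝ) < 1 / 2 by norm_num)] with ε hb hε
      obtain ⟨η, hη, hηK⟩ := hmoll ε hε.1
      set E : ℝ → ℝ := fun t => ∫ x, (inner ℝ (v t x) (mollify η (v t) x) : ℝ) ∂torusMeasure with hE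
      have e1 : ∀ t ∈ Icc 0 T, ‖E t - E 0‖ₑ ≤ 2 * _ := fun t ht =>
        (hη.enorm_energy_sub_le hcont hT hEuler hε.2 ht).trans (mul_le_mul_right (hb η hη hηK) 2)
      have e2 : ∀ t ∈ Icc 0 T, MemBesov θ (3 * r) (v t) → ‖E t - l2norm (v t) ^ 2‖ₑ ≤
          ENNReal.ofReal (l2norm (v t) * ((besovSeminorm θ (3 * r) (v t)).toReal * ε ^ θ)) := by
        intro t ht hB
        rw [← ofReal_norm]
        exact ENNReal.ofReal_le_ofReal (abs_energy_mollify_sub_le hθ₀.le hr1.le (hEuler.periodic t ht)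
          (hcont.1 t ht) hB hη)
      have e3 : l2norm (v t) ^ 2 - l2norm (v t') ^ 2 =
          (((E t - E 0) - (E t' - E 0)) - (E t - l2norm (v t) ^ 2)) +
            (E t' - l2norm (v t') ^ 2) := by ring
      rw [e3]
      refine (enorm_add_le _ _).trans ((add_le_add ((enorm_sub_le).trans (add_le_add
        ((enorm_sub_le).trans (add_le_add (e1 t ht) (e1 t' ht'))) (e2 t ht hB)))
        (e2 t' ht' hB')).trans (le_of_eq ?_))
      ring
    have h0 : ‖l2norm (v t) ^ 2 - l2norm (v t') ^ 2‖ₑ = 0 := le_antisymm hle zero_le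
    exact sub_eq_zero.1 (enorm_eq_zero.1 h0)
  have hae : ∀ᵐ t ∂(volume.restrict (Icc 0 T)), MemBesov θ (3 * r) (v t) := by
    rw [← restrict_Ioo_eq_restrict_Icc]
    exact hBesov.1
  have : (ae (volume.restrict (Icc 0 T))).NeBot := by
    rw [ae_neBot, Ne, Measure.restrict_eq_zero]
    simpa using hT
  obtain ⟨t₀, ht₀B, ht₀⟩ := (hae.and (ae_restrict_mem measurableSet_Icc)).exists
  have hke : ∀ t ∈ Icc 0 T, kineticEnergy v t = (1 / 2) * l2norm (v t) ^ 2 := fun t ht => by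
    rw [kineticEnergy, integral_norm_sq_eq (hcont.1 t ht)]
  -- Continuous functions that agree almost everywhere on `[0, T]` agree everywhere, so time `0` is
  -- covered even if `v(0)` is not a Besov field.
  have hconst : EqOn (kineticEnergy v) (fun _ => kineticEnergy v t₀) (Icc 0 T) := by
    refine Measure.eqOn_Icc_of_ae_eq volume hT.ne ?_ hcont.continuousOn_kineticEnergy
      continuousOn_const
    filter_upwards [hae, ae_restrict_mem measurableSet_Icc] with t htB ht
    rw [hke t ht, hke t₀ ht₀, hgood t ht t₀ ht₀ htB ht₀B]
  intro t ht
  rw [hconst ht, hconst ⟨le_rfl, hT.le⟩]
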